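/- Let $d,m\in\mathbb N$ and let $|\cdot|$ denote the determinant. For a positive definite $Q\in\mathbb R^{d\times d}$ and a real $n>d-1$ let $$\mathcal{IW}_V(Q,n)=\frac1{Z_{n,d}}\,\frac1{|V|^{(d+1)/2}}\left|\tfrac12 V^{-1}Q\right|^{n/2}e^{-\frac12\mathrm{tr}(V^{-1}Q)},\qquad Z_{n,d}=\pi^{d(d-1)/4}\prod_{i=1}^d\Gamma\!\left(\tfrac{n+1-i}2\right),$$ be the inverted Wishart density on the positive definite $V\in\mathbb R^{d\times d}$, with respect to $dV=\prod_{i\le j}dV_{ij}$. For $M\in\mathbb R^{d\times m}$ and a positive definite $K\in\mathbb R^{m\times m}$ let $$\mathcal N_A(M,V,K)=\frac{|K|^{d/2}}{|2\pi V|^{m/2}}\,e^{-\frac12\mathrm{tr}((A-M)^TV^{-1}(A-M)K)}$$ be the matrix normal density on $\mathbb R^{d\times m}$, with respect to Lebesgue measure $dA$, and let $\mathcal N_y(\mu,V)$ be the density of the normal distribution on $\mathbb R^d$ with mean $\mu$ and covariance matrix $V$. Let $(A,V)$ have the prior density $\mathcal N_A(M,V,K)\,\mathcal{IW}_V(Q,n)$,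 and for an input $x\in\mathbb R^m$ let $y$ have the conditional density $\mathcal N_y(Ax,V)$ given $(A,V)$. Let $$p(y|x)=\int\!\!\int \mathcal N_y(Ax,V)\,\mathcal N_A(M,V,K)\,\mathcal{IW}_V(Q,n)\,dA\,dV$$ be the predictive density, let $$p(A,V|x,y)=\frac{\mathcal N_y(Ax,V)\,\mathcal N_A(M,V,K)\,\mathcal{IW}_V(Q,n)}{p(y|x)}$$ be the posterior density, and let $H(A,V;x,y)=-\int\!\int p(A,V|x,y)\ln p(A,V|x,y)\,dA\,dV$ be its differential entropy. Then there is a real-valued function $g_1$ of $Q$ and $n$, depending on the dimensions $d$ and $m$ but not on $x$, $M$ or $K$, such that for all $Q,n,M,K,x$ as above, $p(y|x)>0$ for every $y\in\mathbb R^d$, the integral that defines $H(A,V;x,y)$ converges absolutely for every $y$, the integral over $y$ below converges absolutely, and $$H(A,V|y;x)=\int_{\mathbb R^d}p(y|x)\,H(A,V;x,y)\,dy=-\frac d2\ln|xx^T+K|+g_1(Q,n).$$ -/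

import Mathlib

open MeasureTheory
open scoped Matrix

namespace BayesInfomax

noncomputable section

/-- The symmetric matrix with independent entries `v`, one for every unordered pair of indices.
Lebesgue measure on symmetric `d × d` matrices is `∏_{i ≤ j} dV_{ij}`, that is, `volume` on the
coordinate space `Sym2 (Fin d) → ℝ`. -/
def symMatrix {d : ℕ} (v : Sym2 (Fin d) → ℝ) : Matrix (Fin d) (Fin d) ℝ :=
  Matrix.of fun i j => v s(i, j)

/-- Density at `y` of the normal distribution on `ℝ^d` with mean `μ` and covariance matrix `V`. -/
def normalDensity {d : ℕ} (μ : Fin d → ℝ) (V : Matrix (Fin d) (Fin d) ℝ) (y : Fin d → ℝ) : ℝ :=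
  (((2 * Real.pi) • V).det ^ (1 / 2 : ℝ))⁻¹ *
    Real.exp (-(1 / 2) * ((y - μ) ⬝ᵥ (V⁻¹ *ᵥ (y - μ))))

/-- Density at `A` of the matrix normal distribution with mean `M`, covariance parameter `V` and
precision parameter `K`. -/
def matrixNormalDensity {d m : ℕ} (M : Matrix (Fin d) (Fin m) ℝ) (V : Matrix (Fin d) (Fin d) ℝ)
    (K : Matrix (Fin m) (Fin m) ℝ) (A : Matrix (Fin d) (Fin m) ℝ) : ℝ :=
  K.det ^ ((d : ℝ) / 2) / ((2 * Real.pi) • V).det ^ ((m : ℝ) / 2) *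
    Real.exp (-(1 / 2) * ((A - M)ᵀ * V⁻¹ * (A - M) * K).trace)

/-- The constant `Z_{n,d} = π^{d(d-1)/4} ∏_{i=1}^d Γ((n+1-i)/2)`. -/
def wishartZ (n : ℝ) (d : ℕ) : ℝ :=
  Real.pi ^ ((d : ℝ) * ((d : ℝ) - 1) / 4) *
    ∏ i ∈ Finset.Icc 1 d, Real.Gamma ((n + 1 - (i : ℝ)) / 2)

open Classical in
/-- Density at `V` of the inverted Wishart distribution with parameters `Q` and `n`; it is
supported on the positive definite matrices. -/
def invWishartDensity {d : ℕ} (Q : Matrix (Fin d) (Fin d) ℝ) (n : ℝ)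
    (V : Matrix (Fin d) (Fin d) ℝ) : ℝ :=
  if V.PosDef then
    1 / wishartZ n d * (1 / V.det ^ (((d : ℝ) + 1) / 2)) *
      ((1 / 2 : ℝ) • (V⁻¹ * Q)).det ^ (n / 2) * Real.exp (-(1 / 2) * (V⁻¹ * Q).trace)
  else 0

/-- Coordinates of the parameter `θ = (A, V)`: all entries of `A` and the independent entries of
the symmetric matrix `V`. Its `volume` is Lebesgue measure `dA dV`. -/
abbrev Param (d m : ℕ) : Type := (Fin d → Fin m → ℝ) × (Sym2 (Fin d) → ℝ)

/-- The matrix `A` of the parameter `θ = (A, V)`. -/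
def Param.coeff {d m : ℕ} (θ : Param d m) : Matrix (Fin d) (Fin m) ℝ := Matrix.of θ.1

/-- The matrix `V` of the parameter `θ = (A, V)`. -/
def Param.cov {d m : ℕ} (θ : Param d m) : Matrix (Fin d) (Fin d) ℝ := symMatrix θ.2

/-- Prior density of `(A, V)`: `V` is inverted Wishart with parameters `Q`, `n`, and given `V`
the matrix `A` is matrix normal with parameters `M`, `V`, `K`. -/
def priorDensity {d m : ℕ} (M : Matrix (Fin d) (Fin m) ℝ) (K : Matrix (Fin m) (Fin m) ℝ)
    (Q : Matrix (Fin d) (Fin d) ℝ) (n : ℝ) (θ : Param d m) : ℝ :=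
  matrixNormalDensity M θ.cov K θ.coeff * invWishartDensity Q n θ.cov

/-- Joint density of `(A, V)` and `y` for the input `x`, where `y` given `A`, `V`, `x` is normal
with mean `A x` and covariance matrix `V`. -/
def jointDensity {d m : ℕ} (M : Matrix (Fin d) (Fin m) ℝ) (K : Matrix (Fin m) (Fin m) ℝ)
    (Q : Matrix (Fin d) (Fin d) ℝ) (n : ℝ) (x : Fin m → ℝ) (y : Fin d → ℝ) (θ : Param d m) : ℝ :=
  normalDensity (θ.coeff *ᵥ x) θ.cov y * priorDensity M K Q n θ

/-- Predictive density `p(y | x)`. -/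
def predictiveDensity {d m : ℕ} (M : Matrix (Fin d) (Fin m) ℝ) (K : Matrix (Fin m) (Fin m) ℝ)
    (Q : Matrix (Fin d) (Fin d) ℝ) (n : ℝ) (x : Fin m → ℝ) (y : Fin d → ℝ) : ℝ :=
  ∫ θ : Param d m, jointDensity M K Q n x y θ

/-- Posterior density `p(A, V | x, y)`, by Bayes' rule. -/
def posteriorDensity {d m : ℕ} (M : Matrix (Fin d) (Fin m) ℝ) (K : Matrix (Fin m) (Fin m) ℝ)
    (Q : Matrix (Fin d) (Fin d) ℝ) (n : ℝ) (x : Fin m → ℝ) (y : Fin d → ℝ) (θ : Param d m) : ℝ :=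
  jointDensity M K Q n x y θ / predictiveDensity M K Q n x y

/-- Differential entropy `-∫ f ln f` of a density `f` with respect to `volume`. -/
def differentialEntropy {α : Type*} [MeasureSpace α] (f : α → ℝ) : ℝ :=
  -∫ a, f a * Real.log (f a)

/-- The entropy `H(A, V; x, y)` of the posterior distribution of `(A, V)` given `x`, `y`. -/
def posteriorEntropy {d m : ℕ} (M : Matrix (Fin d) (Fin m) ℝ) (K : Matrix (Fin m) (Fin m) ℝ)
    (Q : Matrix (Fin d) (Fin d) ℝ) (n : ℝ) (x : Fin m → ℝ) (y : Fin d → ℝ) : ℝ :=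
  differentialEntropy (posteriorDensity M K Q n x y)

/-- The conditional entropy `H(A, V | y; x) = ∫ p(y | x) H(A, V; x, y) dy`. -/
def expectedPosteriorEntropy {d m : ℕ} (M : Matrix (Fin d) (Fin m) ℝ)
    (K : Matrix (Fin m) (Fin m) ℝ) (Q : Matrix (Fin d) (Fin d) ℝ) (n : ℝ) (x : Fin m → ℝ) : ℝ :=
  ∫ y : Fin d → ℝ, predictiveDensity M K Q n x y * posteriorEntropy M K Q n x y

end

end BayesInfomax

/-! The model is conjugate. Put K' = xxᵀ + K, u = K'⁻¹x, z = y - Mx and c = 1 - xᵀu = |K| / |K'|.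
Completing the square shows that likelihood times prior equals a factor depending on y times the
prior density with parameters M + zuᵀ, K', Q' = Q + c zzᵀ and n + 1 (`quadratic_add_priorExponent`,
`jointDensity_eq`). Since prior densities have mass one, that factor is p(y|x) and the other one is
the posterior.

The mass of the prior comes from two integrals. The integral over A is Gaussian with Kronecker
precision matrix. The integral over V goes by induction on d: V is split into a corner, a border and
a Schur complement, which contribute an inverse gamma integral, a Gaussian integral and an inverted
Wishart integral of size d with the same n (`lintegral_invWishartKernel`).

The entropy of a prior density f needs no moments of ln|V|. The power f^(1+t) is a constant times
another density of the family, so ∫ f^(1+t) is explicit for t near 0. It is the moment generating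
function of ln f under f. Finiteness near 0 gives absolute convergence of ∫ f ln f, and the
derivative at 0 gives its value (`entropy_priorDensity`). The entropy is -(d/2) ln|K| + ((d+m+1)/2)
ln|Q| plus a constant depending on d, m and n.

For the posterior, K' yields the announced term and ln|Q'| has to be averaged over y. In the
variable √c z the predictive density becomes a t density determined by Q and n, and Q' becomes Q
plus the rank-one matrix of that variable. Hence the average depends only on Q and n. -/

namespace BayesInfomax

/-! ### Gaussian, inverse gamma and matrix normal integrals -/

/-- The integral of a product of standard Gaussian kernels. -/
theorem lintegral_exp_neg_half_dotProduct_self {ι : Type*} [Fintype ι] :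
    ∫⁻ w : ι → ℝ, ENNReal.ofReal (Real.exp (-(1 / 2) * (w ⬝ᵥ w))) =
      ENNReal.ofReal (Real.exp ((Fintype.card ι : ℝ) / 2 * Real.log (2 * Real.pi))) := by
  have hprod : ∀ w : ι → ℝ, Real.exp (-(1 / 2) * (w ⬝ᵥ w)) =
      ∏ i, Real.exp (-(1 / 2) * w i ^ 2) := by
    intro w
    rw [← Real.exp_sum, ← Finset.mul_sum]
    simp [dotProduct, sq]
  have hint : Integrable (fun t : ℝ => Real.exp (-(1 / 2) * t ^ 2)) :=
    integrable_exp_neg_mul_sq (by norm_num)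
  simp_rw [hprod]
  have hpi : Integrable (fun w : ι → ℝ => ∏ i, Real.exp (-(1 / 2) * w i ^ 2)) :=
    Integrable.fintype_prod (f := fun _ t => Real.exp (-(1 / 2) * t ^ 2)) fun _ => hint
  rw [← ofReal_integral_eq_lintegral_ofReal hpi
      (Filter.Eventually.of_forall fun w => Finset.prod_nonneg fun i _ => (Real.exp_pos _).le),
    integral_fintype_prod_volume_eq_prod (fun _ t => Real.exp (-(1 / 2) * t ^ 2))]
  congr 1
  rw [Finset.prod_const, integral_gaussian, Finset.card_univ,
    show Real.pi / (1 / 2) = 2 * Real.pi by ring, Real.sqrt_eq_rpow, ← Real.rpow_mul_natCast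
      (by positivity), Real.rpow_def_of_pos (by positivity)]
  congr 1
  ring

/-- The Gaussian integral with an arbitrary precision matrix. -/
theorem lintegral_exp_neg_half_quadratic {ι : Type*} [Fintype ι] [DecidableEq ι]
    {P : Matrix ι ι ℝ} (hP : P.PosDef) :
    ∫⁻ v : ι → ℝ, ENNReal.ofReal (Real.exp (-(1 / 2) * (v ⬝ᵥ (P *ᵥ v)))) =
      ENNReal.ofReal (Real.exp ((Fintype.card ι : ℝ) / 2 * Real.log (2 * Real.pi)
        - 1 / 2 * Real.log P.det)) := by
  -- The substitution w = Bv reduces the form to w ⬝ w, with Jacobian |det B| = √(det P).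
  obtain ⟨B, hB⟩ : ∃ B : Matrix ι ι ℝ, P = Bᵀ * B := by
    open scoped MatrixOrder in
    obtain ⟨B, hB⟩ := CStarAlgebra.nonneg_iff_eq_star_mul_self.mp
      (Matrix.nonneg_iff_posSemidef.mpr hP.posSemidef)
    exact ⟨B, by rw [hB, Matrix.star_eq_conjTranspose, Matrix.conjTranspose_eq_transpose_of_trivial]⟩
  have hdet : P.det = B.det ^ 2 := by rw [hB, Matrix.det_mul, Matrix.det_transpose, sq]
  have hB0 : B.det ≠ 0 := by
    intro h
    have := hP.det_pos
    simp [hdet, h] at this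
  have hq : ∀ v : ι → ℝ, v ⬝ᵥ (P *ᵥ v) = (Matrix.toLin' B v) ⬝ᵥ (Matrix.toLin' B v) := by
    intro v
    rw [hB, Matrix.toLin'_apply, ← Matrix.mulVec_mulVec, Matrix.dotProduct_mulVec,
      Matrix.vecMul_transpose]
  have hmeas : Measurable fun w : ι → ℝ =>
      ENNReal.ofReal (Real.exp (-(1 / 2) * (w ⬝ᵥ w))) := by
    unfold dotProduct
    fun_prop
  simp_rw [hq]
  rw [← lintegral_map (g := Matrix.toLin' B) hmeas
      (Matrix.toLin' B).continuous_of_finiteDimensional.measurable,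
    Real.map_matrix_volume_pi_eq_smul_volume_pi hB0, lintegral_smul_measure,
    lintegral_exp_neg_half_dotProduct_self, smul_eq_mul, ← ENNReal.ofReal_mul (abs_nonneg _)]
  congr 1
  rw [hdet, Real.log_pow, sub_eq_add_neg, Real.exp_add, mul_comm]
  congr 1
  -- The sign of `B.det` is unknown; `Real.log` ignores it.
  rw [show -(1 / 2 * (((2 : ℕ) : ℝ) * Real.log B.det)) = -Real.log B.det by push_cast; ring,
    Real.exp_neg, ← Real.log_abs, Real.exp_log (abs_pos.mpr hB0), abs_inv]

/-- The inverse gamma integral. -/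
theorem lintegral_inverse_gamma {p r : ℝ} (hp : 0 < p) (hr : 0 < r) :
    ∫⁻ a in Set.Ioi (0 : ℝ), ENNReal.ofReal (Real.exp (-(p + 1) * Real.log a - r / a)) =
      ENNReal.ofReal (Real.exp (Real.log (Real.Gamma p) - p * Real.log r)) := by
  have himg : (fun x : ℝ => x⁻¹) '' Set.Ioi 0 = Set.Ioi 0 := by
    ext x
    exact ⟨by rintro ⟨y, hy, rfl⟩; exact inv_pos.mpr (Set.mem_Ioi.mp hy),
      fun hx => ⟨x⁻¹, Set.mem_Ioi.mpr (inv_pos.mpr (Set.mem_Ioi.mp hx)), inv_inv x⟩⟩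
  -- The substitution t = 1/a leads to Euler's integral for Γ(p).
  have hsub := lintegral_image_eq_lintegral_abs_deriv_mul (s := Set.Ioi (0 : ℝ))
    measurableSet_Ioi (f := fun x => x⁻¹) (f' := fun x => -(x ^ 2)⁻¹)
    (fun x hx => (hasDerivAt_inv (ne_of_gt hx)).hasDerivWithinAt)
    inv_injective.injOn (fun t => ENNReal.ofReal (t ^ (p - 1) * Real.exp (-(r * t))))
  rw [himg] at hsub
  have hval : ∫ t : ℝ in Set.Ioi 0, t ^ (p - 1) * Real.exp (-(r * t)) =
      (1 / r) ^ p * Real.Gamma p := Real.integral_rpow_mul_exp_neg_mul_Ioi hp hr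
  have hne : (1 / r) ^ p * Real.Gamma p ≠ 0 :=
    (mul_pos (Real.rpow_pos_of_pos (by positivity) _) (Real.Gamma_pos_of_pos hp)).ne'
  have hint : IntegrableOn (fun t : ℝ => t ^ (p - 1) * Real.exp (-(r * t))) (Set.Ioi 0) := by
    -- A non-integrable function would have Bochner integral 0, but the value found is nonzero.
    by_contra h
    exact hne (hval ▸ integral_undef h)
  have hleft : ∫⁻ t in Set.Ioi (0 : ℝ), ENNReal.ofReal (t ^ (p - 1) * Real.exp (-(r * t))) =
      ENNReal.ofReal (Real.exp (Real.log (Real.Gamma p) - p * Real.log r)) := by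
    rw [← ofReal_integral_eq_lintegral_ofReal hint, hval]
    · rw [sub_eq_add_neg, Real.exp_add, Real.exp_log (Real.Gamma_pos_of_pos hp), mul_comm,
        Real.rpow_def_of_pos (by positivity), one_div, Real.log_inv]
      congr 3
      ring
    · filter_upwards [ae_restrict_mem measurableSet_Ioi] with t ht
      exact mul_nonneg (Real.rpow_nonneg (le_of_lt ht) _) (Real.exp_pos _).le
  rw [← hleft, hsub]
  refine setLIntegral_congr_fun measurableSet_Ioi fun a ha => ?_
  have ha : 0 < a := ha
  rw [← ENNReal.ofReal_mul (abs_nonneg _), abs_neg, abs_of_pos (by positivity),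
    Real.rpow_def_of_pos (by positivity), ← Real.exp_log (show 0 < (a ^ 2)⁻¹ by positivity),
    ← Real.exp_add, ← Real.exp_add, Real.log_inv, Real.log_inv, Real.log_pow]
  congr 2
  push_cast
  ring

/-- Lebesgue measure on matrices, in curried and uncurried form. -/
theorem measurePreserving_uncurry (ι κ : Type*) [Fintype ι] [Fintype κ] :
    MeasurePreserving (fun (f : ι → κ → ℝ) (p : ι × κ) => f p.1 p.2) := by
  refine ⟨by fun_prop, (Measure.pi_eq fun s hs => ?_).symm⟩
  rw [Measure.map_apply (by fun_prop) (.univ_pi hs)]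
  have : (fun (f : ι → κ → ℝ) (p : ι × κ) => f p.1 p.2) ⁻¹' Set.univ.pi s =
      Set.univ.pi fun i => Set.univ.pi fun j => s (i, j) := by
    ext f
    simp
  rw [this, volume_pi_pi, Fintype.prod_prod_type]
  simp_rw [volume_pi_pi]

/-- The quadratic form of a matrix normal density is that of a Kronecker product. -/
theorem trace_transpose_mul_mul_mul_eq {ι κ : Type*} [Fintype ι] [Fintype κ]
    (W : Matrix ι ι ℝ) {K : Matrix κ κ ℝ} (hK : K.IsSymm) (A : Matrix ι κ ℝ) :
    (Aᵀ * W * A * K).trace = (fun p : ι × κ => A p.1 p.2) ⬝ᵥ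
      (Matrix.kronecker W K *ᵥ fun p : ι × κ => A p.1 p.2) := by
  have hentry : ∀ i j, (W * A * K) i j =
      (Matrix.kronecker W K *ᵥ fun p : ι × κ => A p.1 p.2) (i, j) := by
    intro i j
    simp only [Matrix.mul_apply, Matrix.mulVec, dotProduct, Matrix.kronecker,
      Matrix.kroneckerMap_apply, Fintype.sum_prod_type, Finset.sum_mul]
    rw [Finset.sum_comm]
    refine Finset.sum_congr rfl fun k _ => Finset.sum_congr rfl fun l _ => ?_
    rw [hK.apply j l]
    ring
  rw [Matrix.mul_assoc, Matrix.mul_assoc, ← Matrix.mul_assoc W, Matrix.trace, dotProduct,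
    Fintype.sum_prod_type_right]
  refine Finset.sum_congr rfl fun j _ => ?_
  rw [Matrix.diag_apply, Matrix.mul_apply]
  exact Finset.sum_congr rfl fun i _ => by rw [hentry, Matrix.transpose_apply]

/-- The matrix normal kernel integrates to the inverse of its normalizing constant. -/
theorem lintegral_matrixNormal_kernel {d m : ℕ} (M : Matrix (Fin d) (Fin m) ℝ)
    {V : Matrix (Fin d) (Fin d) ℝ} {K : Matrix (Fin m) (Fin m) ℝ} (hV : V.PosDef)
    (hK : K.PosDef) :
    ∫⁻ A : Fin d → Fin m → ℝ, ENNReal.ofReal (Real.exp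
        (-(1 / 2) * ((Matrix.of A - M)ᵀ * V⁻¹ * (Matrix.of A - M) * K).trace)) =
      ENNReal.ofReal (Real.exp ((d : ℝ) * m / 2 * Real.log (2 * Real.pi)
        + m / 2 * Real.log V.det - d / 2 * Real.log K.det)) := by
  have hP : (Matrix.kronecker V⁻¹ K).PosDef := hV.inv.kronecker hK
  have hsymm : K.IsSymm := by
    have := hK.isHermitian
    rwa [Matrix.IsHermitian, Matrix.conjTranspose_eq_transpose_of_trivial] at this
  have hmeas : Measurable fun v : Fin d × Fin m → ℝ => ENNReal.ofReal (Real.exp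
      (-(1 / 2) * (v ⬝ᵥ (Matrix.kronecker V⁻¹ K *ᵥ v)))) := by
    unfold dotProduct Matrix.mulVec dotProduct
    fun_prop
  calc _ = ∫⁻ A : Fin d → Fin m → ℝ, ENNReal.ofReal (Real.exp
        (-(1 / 2) * ((Matrix.of A)ᵀ * V⁻¹ * Matrix.of A * K).trace)) :=
        lintegral_sub_right_eq_self (μ := (volume : Measure (Fin d → Fin m → ℝ)))
          (fun A => ENNReal.ofReal (Real.exp
            (-(1 / 2) * ((Matrix.of A)ᵀ * V⁻¹ * Matrix.of A * K).trace))) M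
    _ = ∫⁻ v : Fin d × Fin m → ℝ, ENNReal.ofReal (Real.exp
          (-(1 / 2) * (v ⬝ᵥ (Matrix.kronecker V⁻¹ K *ᵥ v)))) := by
        rw [← (measurePreserving_uncurry (Fin d) (Fin m)).lintegral_comp hmeas]
        simp_rw [trace_transpose_mul_mul_mul_eq _ hsymm]
        rfl
    _ = _ := by
        rw [lintegral_exp_neg_half_quadratic hP]
        have hVd := hV.det_pos
        have hKd := hK.det_pos
        congr 2
        rw [Matrix.kronecker, Matrix.det_kronecker, Matrix.det_nonsing_inv, Ring.inverse_eq_inv',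
          Real.log_mul (x := V.det⁻¹ ^ _) (by positivity) (by positivity), Real.log_pow,
          Real.log_pow, Real.log_inv, Fintype.card_prod, Fintype.card_fin, Fintype.card_fin]
        push_cast
        ring

/-! ### Bordered matrices and Schur complements -/

/-- The symmetric block matrix with corner `a`, border `b` and Schur complement `S`. -/
noncomputable def borderedMatrix {κ : Type*} (a : ℝ) (b : κ → ℝ) (S : Matrix κ κ ℝ) :
    Matrix (Unit ⊕ κ) (Unit ⊕ κ) ℝ :=
  Matrix.fromBlocks (Matrix.of fun _ _ => a) (Matrix.of fun _ j => b j)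
    (Matrix.of fun i _ => b i) (S + a⁻¹ • Matrix.vecMulVec b b)

section Bordered

variable {κ : Type*} [Fintype κ] [DecidableEq κ]

theorem inv_unit_matrix (a : ℝ) :
    (Matrix.of fun _ _ => a : Matrix Unit Unit ℝ)⁻¹ = Matrix.of fun _ _ => a⁻¹ := by
  rw [Matrix.inv_subsingleton]
  ext i j
  simp

omit [Fintype κ] [DecidableEq κ] in
theorem schur_borderedMatrix (a : ℝ) (b : κ → ℝ) (S : Matrix κ κ ℝ) :
    (S + a⁻¹ • Matrix.vecMulVec b b) - (Matrix.of fun i (_ : Unit) => b i) *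
      (Matrix.of fun _ _ => a : Matrix Unit Unit ℝ)⁻¹ * (Matrix.of fun (_ : Unit) j => b j) = S := by
  rw [inv_unit_matrix]
  ext i j
  simp [Matrix.mul_apply, Matrix.vecMulVec_apply]
  ring

theorem det_borderedMatrix {a : ℝ} (ha : a ≠ 0) (b : κ → ℝ) (S : Matrix κ κ ℝ) :
    (borderedMatrix a b S).det = a * S.det := by
  have hdet : (Matrix.of fun _ _ => a : Matrix Unit Unit ℝ).det = a := by simp
  have : Invertible (Matrix.of fun _ _ => a : Matrix Unit Unit ℝ) :=
    Matrix.invertibleOfIsUnitDet _ (by rw [hdet]; exact ha.isUnit)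
  rw [borderedMatrix, Matrix.det_fromBlocks₁₁, Matrix.invOf_eq_nonsing_inv,
    schur_borderedMatrix, hdet]

theorem posDef_borderedMatrix_iff {a : ℝ} (b : κ → ℝ) (S : Matrix κ κ ℝ) :
    (borderedMatrix a b S).PosDef ↔ 0 < a ∧ S.PosDef := by
  have hpos : (borderedMatrix a b S).PosDef → 0 < a := fun h => by
    simpa [borderedMatrix] using h.diag_pos (i := Sum.inl ())
  by_cases ha : 0 < a
  · have hA : (Matrix.of fun _ _ => a : Matrix Unit Unit ℝ).PosDef := by
      have : (Matrix.of fun _ _ => a : Matrix Unit Unit ℝ) = Matrix.diagonal fun _ => a := by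
        ext i j; simp
      rw [this]
      exact Matrix.posDef_diagonal_iff.mpr fun _ => ha
    have : Invertible (Matrix.of fun _ _ => a : Matrix Unit Unit ℝ) :=
      Matrix.invertibleOfIsUnitDet _ (by simpa using ha.ne')
    have hpsd : (borderedMatrix a b S).PosSemidef ↔ S.PosSemidef := by
      have h := hA.fromBlocks₁₁ (Matrix.of fun (_ : Unit) j => b j)
        (S + a⁻¹ • Matrix.vecMulVec b b)
      have ht : (Matrix.of fun (_ : Unit) j => b j)ᴴ = Matrix.of fun i (_ : Unit) => b i := by
        ext i j; simp
      rw [ht, schur_borderedMatrix] at h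
      exact h
    -- The Schur criterion for semidefiniteness passes to definiteness because the determinant
    -- factors as a |S|.
    have hiff {ι : Type _} [Fintype ι] [DecidableEq ι] (A : Matrix ι ι ℝ) :
        A.PosDef ↔ A.PosSemidef ∧ A.det ≠ 0 :=
      ⟨fun h => ⟨h.posSemidef, h.det_pos.ne'⟩, fun h => h.1.posDef_iff_det_ne_zero.mpr h.2⟩
    rw [hiff, hiff S, hpsd, det_borderedMatrix ha.ne']
    simp [ha, ha.ne']
  · exact ⟨fun h => absurd (hpos h) ha, fun h => absurd h.1 ha⟩

theorem inv_borderedMatrix {a : ℝ} (ha : a ≠ 0) (b : κ → ℝ) {S : Matrix κ κ ℝ}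
    (hS : IsUnit S.det) (hsymm : S⁻¹.IsSymm) :
    (borderedMatrix a b S)⁻¹ = Matrix.fromBlocks
      (Matrix.of fun _ _ => a⁻¹ + a⁻¹ ^ 2 * (b ⬝ᵥ (S⁻¹ *ᵥ b)))
      (Matrix.of fun _ j => -a⁻¹ * (S⁻¹ *ᵥ b) j)
      (Matrix.of fun i _ => -a⁻¹ * (S⁻¹ *ᵥ b) i) S⁻¹ := by
  have hSb : S *ᵥ (S⁻¹ *ᵥ b) = b := by
    rw [Matrix.mulVec_mulVec, Matrix.mul_nonsing_inv _ hS, Matrix.one_mulVec]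
  have hbS : b ᵥ* S⁻¹ = S⁻¹ *ᵥ b := by
    rw [← Matrix.mulVec_transpose, hsymm.eq]
  refine Matrix.inv_eq_right_inv ?_
  rw [borderedMatrix, Matrix.fromBlocks_multiply, ← Matrix.fromBlocks_one]
  have hrow : ∀ j, ∑ k, b k * S⁻¹ k j = (S⁻¹ *ᵥ b) j := fun j => congrFun hbS j
  have hdot : ∑ k, b k * (-a⁻¹ * (S⁻¹ *ᵥ b) k) = -a⁻¹ * (b ⬝ᵥ (S⁻¹ *ᵥ b)) := by
    rw [dotProduct, Finset.mul_sum]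
    exact Finset.sum_congr rfl fun k _ => by ring
  congr 1
  · ext i j
    simp only [Matrix.add_apply, Matrix.mul_apply, Matrix.of_apply, Finset.univ_unique,
      Finset.sum_singleton, hdot, Matrix.one_apply, if_true]
    field_simp
    simp
  · ext i j
    simp only [Matrix.add_apply, Matrix.mul_apply, Matrix.of_apply, Finset.univ_unique,
      Finset.sum_singleton, hrow, Matrix.zero_apply]
    field_simp
    simp
  · ext i j
    have h1 : ((S + a⁻¹ • Matrix.vecMulVec b b) *
        (Matrix.of fun i (_ : Unit) => -a⁻¹ * (S⁻¹ *ᵥ b) i)) i j =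
        -a⁻¹ * (b i + a⁻¹ * b i * (b ⬝ᵥ (S⁻¹ *ᵥ b))) := by
      have : ((S + a⁻¹ • Matrix.vecMulVec b b) *
        (Matrix.of fun i (_ : Unit) => -a⁻¹ * (S⁻¹ *ᵥ b) i)) i j =
          ((S + a⁻¹ • Matrix.vecMulVec b b) *ᵥ (-a⁻¹ • (S⁻¹ *ᵥ b))) i := by
        simp [Matrix.mul_apply, Matrix.mulVec, dotProduct]
      rw [this, Matrix.mulVec_smul, Matrix.add_mulVec, hSb, Matrix.smul_mulVec,
        Matrix.vecMulVec_mulVec]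
      simp only [Pi.smul_apply, Pi.add_apply, smul_eq_mul, MulOpposite.smul_eq_mul_unop,
        MulOpposite.unop_op]
      ring
    rw [Matrix.add_apply, h1]
    simp only [Matrix.mul_apply, Matrix.of_apply, Finset.univ_unique,
      Finset.sum_singleton, Matrix.zero_apply]
    ring
  · rw [Matrix.add_mul, Matrix.mul_nonsing_inv _ hS]
    ext i j
    simp only [Matrix.add_apply, Matrix.mul_apply, Matrix.of_apply, Finset.univ_unique,
      Finset.sum_singleton, Matrix.smul_apply, Matrix.vecMulVec_apply, smul_eq_mul]
    have : ∑ x, a⁻¹ * (b i * b x) * S⁻¹ x j = a⁻¹ * b i * (S⁻¹ *ᵥ b) j := by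
      rw [← hrow, Finset.mul_sum]
      exact Finset.sum_congr rfl fun k _ => by ring
    rw [this]
    ring

/-- The trace is quadratic in b. The term q⁻¹ r rᵀ in the lower block of the second matrix is
exactly the constant that completes the square. The integral over b thus becomes Gaussian, centred
at (a/q) r with precision (q/a²) S⁻¹. -/
theorem trace_inv_borderedMatrix_mul {a q : ℝ} (ha : a ≠ 0) (hq : q ≠ 0) (b r : κ → ℝ)
    {S R : Matrix κ κ ℝ} (hS : IsUnit S.det) (hsymm : S⁻¹.IsSymm) :
    ((borderedMatrix a b S)⁻¹ * borderedMatrix q r R).trace =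
      q / a + (b - (a / q) • r) ⬝ᵥ (((q / a ^ 2) • S⁻¹) *ᵥ (b - (a / q) • r)) +
        (S⁻¹ * R).trace := by
  have hcomm : b ⬝ᵥ (S⁻¹ *ᵥ r) = r ⬝ᵥ (S⁻¹ *ᵥ b) := by
    rw [Matrix.dotProduct_mulVec, ← Matrix.mulVec_transpose, hsymm.eq, dotProduct_comm]
  have hrr : (S⁻¹ * Matrix.vecMulVec r r).trace = r ⬝ᵥ (S⁻¹ *ᵥ r) := by
    rw [Matrix.mul_vecMulVec, Matrix.trace_vecMulVec, dotProduct_comm]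
  have h1 : ((Matrix.of fun (_ : Unit) j => -a⁻¹ * (S⁻¹ *ᵥ b) j) *
      (Matrix.of fun i (_ : Unit) => r i)).trace = -a⁻¹ * (r ⬝ᵥ (S⁻¹ *ᵥ b)) := by
    simp only [Matrix.trace, Matrix.diag_apply, Matrix.mul_apply, Matrix.of_apply,
      Finset.univ_unique, Finset.sum_singleton, dotProduct, Finset.mul_sum]
    exact Finset.sum_congr rfl fun k _ => by ring
  have h2 : ((Matrix.of fun i (_ : Unit) => -a⁻¹ * (S⁻¹ *ᵥ b) i) *
      (Matrix.of fun (_ : Unit) j => r j)).trace = -a⁻¹ * (r ⬝ᵥ (S⁻¹ *ᵥ b)) := by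
    simp only [Matrix.trace, Matrix.diag_apply, Matrix.mul_apply, Matrix.of_apply,
      Finset.univ_unique, Finset.sum_singleton, dotProduct, Finset.mul_sum]
    exact Finset.sum_congr rfl fun k _ => by ring
  have h3 : ((Matrix.of fun (_ : Unit) (_ : Unit) => a⁻¹ + a⁻¹ ^ 2 * (b ⬝ᵥ (S⁻¹ *ᵥ b))) *
      (Matrix.of fun (_ : Unit) (_ : Unit) => q)).trace =
        (a⁻¹ + a⁻¹ ^ 2 * (b ⬝ᵥ (S⁻¹ *ᵥ b))) * q := by
    simp [Matrix.trace, Matrix.mul_apply]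
  have htr : ∀ (A : Matrix Unit Unit ℝ) (B : Matrix Unit κ ℝ) (C : Matrix κ Unit ℝ)
      (D : Matrix κ κ ℝ), (Matrix.fromBlocks A B C D).trace = A.trace + D.trace := fun A B C D => by
    simp [Matrix.trace, Fintype.sum_sum_type]
  rw [inv_borderedMatrix ha b hS hsymm, borderedMatrix, Matrix.fromBlocks_multiply,
    htr, Matrix.trace_add, Matrix.trace_add, h1, h2, h3, Matrix.mul_add,
    Matrix.trace_add, Matrix.mul_smul, Matrix.trace_smul, hrr]
  simp only [Matrix.smul_mulVec, Matrix.mulVec_sub, Matrix.mulVec_smul, sub_dotProduct,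
    dotProduct_sub, smul_dotProduct, dotProduct_smul, hcomm, smul_eq_mul]
  field_simp
  ring

end Bordered

/-! ### Coordinates on symmetric matrices -/

theorem isHermitian_symMatrix {d : ℕ} (v : Sym2 (Fin d) → ℝ) : (symMatrix v).IsHermitian := by
  ext i j
  simp [symMatrix, Sym2.eq_swap]

theorem continuous_symMatrix {d : ℕ} :
    Continuous (symMatrix : (Sym2 (Fin d) → ℝ) → Matrix (Fin d) (Fin d) ℝ) :=
  continuous_matrix fun _ _ => continuous_apply _

/-- The positive definite cone is the closed semidefinite cone intersected with the open set of
nonzero determinant. -/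
theorem measurableSet_posDef_symMatrix (d : ℕ) :
    MeasurableSet {v : Sym2 (Fin d) → ℝ | (symMatrix v).PosDef} := by
  have h : {v : Sym2 (Fin d) → ℝ | (symMatrix v).PosDef} =
      (⋂ x : Fin d → ℝ, {v | 0 ≤ x ⬝ᵥ (symMatrix v *ᵥ x)}) ∩ {v | (symMatrix v).det ≠ 0} := by
    ext v
    simp only [Set.mem_ofPred_eq, Set.mem_inter_iff, Set.mem_iInter]
    constructor
    · exact fun h => ⟨fun x => by simpa using h.posSemidef.dotProduct_mulVec_nonneg x,
        h.det_pos.ne'⟩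
    · rintro ⟨h1, h2⟩
      have : (symMatrix v).PosSemidef :=
        .of_dotProduct_mulVec_nonneg (isHermitian_symMatrix v) fun x => by simpa using h1 x
      exact this.posDef_iff_det_ne_zero.mpr h2
  rw [h]
  refine (isClosed_iInter fun x => ?_).measurableSet.inter ?_
  · exact isClosed_le continuous_const 
      (Continuous.dotProduct continuous_const (continuous_symMatrix.matrix_mulVec continuous_const))
  · exact (isOpen_ne_fun continuous_symMatrix.matrix_det continuous_const).measurableSet

theorem measurable_det_symMatrix (d : ℕ) :
    Measurable fun v : Sym2 (Fin d) → ℝ => (symMatrix v).det :=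
  continuous_symMatrix.matrix_det.measurable

theorem measurable_inv_symMatrix_apply {d : ℕ} (i j : Fin d) :
    Measurable fun v : Sym2 (Fin d) → ℝ => (symMatrix v)⁻¹ i j := by
  -- With 0⁻¹ = 0, the adjugate formula also covers singular matrices, so no case split is needed.
  simp_rw [Matrix.inv_def, Ring.inverse_eq_inv', Matrix.smul_apply, smul_eq_mul]
  exact (measurable_det_symMatrix d).inv.mul
    ((continuous_symMatrix.matrix_adjugate.matrix_elem i j).measurable)

/-- The unordered pairs of `d + 1` indices: the diagonal pair of `0`, the pairs of `0` with a
successor and the pairs of successors. -/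
def sym2SuccMap (d : ℕ) : Unit ⊕ (Fin d ⊕ Sym2 (Fin d)) → Sym2 (Fin (d + 1)) :=
  Sum.elim (fun _ => s(0, 0)) (Sum.elim (fun i => s(0, i.succ)) (Sym2.map Fin.succ))

theorem bijective_sym2SuccMap (d : ℕ) : Function.Bijective (sym2SuccMap d) := by
  constructor
  · rintro (⟨⟩ | i | p) (⟨⟩ | j | q) h
    · rfl
    · simp [sym2SuccMap, Fin.ext_iff] at h
    · induction q with | _ k l => simp [sym2SuccMap, Fin.ext_iff] at h
    · simp [sym2SuccMap, Fin.ext_iff] at h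
    · simpa [sym2SuccMap, Fin.ext_iff] using h
    · induction q with | _ k l => simp [sym2SuccMap, Fin.ext_iff] at h
    · induction p with | _ k l => simp [sym2SuccMap, Fin.ext_iff] at h
    · induction p with | _ k l => simp [sym2SuccMap, Fin.ext_iff] at h
    · have := Sym2.map.injective (Fin.succ_injective d) h
      rw [this]
  · intro p
    induction p with | _ i j =>
    refine Fin.cases ?_ (fun i => ?_) i
    · refine Fin.cases ⟨Sum.inl (), rfl⟩ (fun j => ⟨Sum.inr (Sum.inl j), rfl⟩) j
    · refine Fin.cases ⟨Sum.inr (Sum.inl i), Sym2.eq_swap⟩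
        (fun j => ⟨Sum.inr (Sum.inr s(i, j)), rfl⟩) j

noncomputable def sym2SuccEquiv (d : ℕ) : Unit ⊕ (Fin d ⊕ Sym2 (Fin d)) ≃ Sym2 (Fin (d + 1)) :=
  Equiv.ofBijective _ (bijective_sym2SuccMap d)

/-- The coordinates of a symmetric matrix of size `d + 1`, assembled from the corner `a`, the
border `b` and the coordinates `c` of the remaining block. -/
noncomputable def glueSym {d : ℕ} (a : ℝ) (b : Fin d → ℝ) (c : Sym2 (Fin d) → ℝ) :
    Sym2 (Fin (d + 1)) → ℝ :=
  fun p => Sum.elim (fun _ => a) (Sum.elim b c) ((sym2SuccEquiv d).symm p)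

theorem glueSym_map {d : ℕ} (a : ℝ) (b : Fin d → ℝ) (c : Sym2 (Fin d) → ℝ)
    (t : Unit ⊕ (Fin d ⊕ Sym2 (Fin d))) :
    glueSym a b c (sym2SuccMap d t) = Sum.elim (fun _ => a) (Sum.elim b c) t := by
  rw [glueSym]
  congr 1
  exact (sym2SuccEquiv d).symm_apply_apply t

theorem measurable_glueSym (d : ℕ) : Measurable
    fun t : ℝ × ((Fin d → ℝ) × (Sym2 (Fin d) → ℝ)) => glueSym t.1 t.2.1 t.2.2 := by
  refine measurable_pi_lambda _ fun p => ?_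
  unfold glueSym
  rcases (sym2SuccEquiv d).symm p with _ | i | q <;> simp only [Sum.elim_inl, Sum.elim_inr] <;>
    fun_prop

/-- Relabelling coordinates preserves product measure; Tonelli then separates corner, border and
block. -/
theorem lintegral_sym2_succ {d : ℕ} {f : (Sym2 (Fin (d + 1)) → ℝ) → ENNReal}
    (hf : Measurable f) :
    ∫⁻ v, f v = ∫⁻ a : ℝ, ∫⁻ b : Fin d → ℝ, ∫⁻ c : Sym2 (Fin d) → ℝ, f (glueSym a b c) := by
  have e1 := (volume_measurePreserving_piCongrLeft (fun _ : Sym2 (Fin (d + 1)) => ℝ)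
    (sym2SuccEquiv d))
  have e2 := volume_measurePreserving_sumPiEquivProdPi_symm
    (fun _ : Unit ⊕ (Fin d ⊕ Sym2 (Fin d)) => ℝ)
  have e3 := volume_measurePreserving_sumPiEquivProdPi_symm (fun _ : Fin d ⊕ Sym2 (Fin d) => ℝ)
  have e4 := (volume_preserving_funUnique Unit ℝ).symm
  have e5 := (e1.comp e2).comp (e4.prod e3)
  have hfun : ∀ t : ℝ × ((Fin d → ℝ) × (Sym2 (Fin d) → ℝ)),
      ((MeasurableEquiv.piCongrLeft (fun _ : Sym2 (Fin (d + 1)) => ℝ) (sym2SuccEquiv d) ∘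
        (MeasurableEquiv.sumPiEquivProdPi fun _ : Unit ⊕ (Fin d ⊕ Sym2 (Fin d)) => ℝ).symm) ∘
        Prod.map (MeasurableEquiv.funUnique Unit ℝ).symm
          (MeasurableEquiv.sumPiEquivProdPi fun _ : Fin d ⊕ Sym2 (Fin d) => ℝ).symm) t =
        glueSym t.1 t.2.1 t.2.2 := by
    intro t
    funext p
    obtain ⟨s, rfl⟩ := (sym2SuccEquiv d).surjective p
    simp only [Function.comp_apply]
    rw [MeasurableEquiv.coe_piCongrLeft, Equiv.piCongrLeft_apply_apply]
    have := glueSym_map t.1 t.2.1 t.2.2 s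
    rw [show sym2SuccEquiv d s = sym2SuccMap d s from rfl, this]
    rcases s with _ | i | q <;> rfl
  have hmeas := hf.comp (measurable_glueSym d)
  rw [← e5.lintegral_comp hf]
  simp_rw [hfun]
  exact (lintegral_prod _ hmeas.aemeasurable).trans (lintegral_congr fun a =>
    lintegral_prod _ (hmeas.comp measurable_prodMk_left).aemeasurable)

/-- The bijection that splits off the first index. -/
def finSuccSumEquiv (d : ℕ) : Unit ⊕ Fin d ≃ Fin (d + 1) :=
  ((finSuccEquiv d).trans ((Equiv.optionEquivSumPUnit (Fin d)).trans (Equiv.sumComm _ _))).symm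

@[simp] theorem finSuccSumEquiv_inl (d : ℕ) (i : Unit) : finSuccSumEquiv d (Sum.inl i) = 0 := by
  simp [finSuccSumEquiv]

@[simp] theorem finSuccSumEquiv_inr (d : ℕ) (i : Fin d) :
    finSuccSumEquiv d (Sum.inr i) = i.succ := by
  simp [finSuccSumEquiv]

/-- The coordinates of the rank-one matrix `b bᵀ`. -/
def rankOneSym {d : ℕ} (b : Fin d → ℝ) : Sym2 (Fin d) → ℝ :=
  Sym2.lift ⟨fun i j => b i * b j, fun _ _ => mul_comm _ _⟩

theorem measurable_rankOneSym (d : ℕ) :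
    Measurable (rankOneSym : (Fin d → ℝ) → Sym2 (Fin d) → ℝ) := by
  refine measurable_pi_lambda _ fun p => ?_
  induction p with | _ i j =>
  simp only [rankOneSym, Sym2.lift_mk]
  fun_prop

/-- Here s is the Schur complement of the corner. For fixed a and b, passing from the lower block to
s is a translation, hence has Jacobian 1. -/
theorem submatrix_symMatrix_glueSym {d : ℕ} (a : ℝ) (b : Fin d → ℝ) (s : Sym2 (Fin d) → ℝ) :
    (symMatrix (glueSym a b (s + a⁻¹ • rankOneSym b))).submatrix
      (finSuccSumEquiv d) (finSuccSumEquiv d) = borderedMatrix a b (symMatrix s) := by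
  have h1 := glueSym_map a b (s + a⁻¹ • rankOneSym b) (Sum.inl ())
  have h2 := fun i => glueSym_map a b (s + a⁻¹ • rankOneSym b) (Sum.inr (Sum.inl i))
  have h3 := fun i j => glueSym_map a b (s + a⁻¹ • rankOneSym b) (Sum.inr (Sum.inr s(i, j)))
  simp only [sym2SuccMap, Sum.elim_inl, Sum.elim_inr, Sym2.map_mk] at h1 h2 h3
  ext i j
  rcases i with i | i <;> rcases j with j | j <;>
    simp only [Matrix.submatrix_apply, finSuccSumEquiv_inl, finSuccSumEquiv_inr, symMatrix,
      borderedMatrix, Matrix.of_apply, Matrix.fromBlocks_apply₁₁, Matrix.fromBlocks_apply₁₂,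
      Matrix.fromBlocks_apply₂₁, Matrix.fromBlocks_apply₂₂, h1, h2, h3]
  · rw [Sym2.eq_swap, h2]
  · rfl

theorem exists_submatrix_eq_borderedMatrix {d : ℕ} {Q : Matrix (Fin (d + 1)) (Fin (d + 1)) ℝ}
    (hQ : Q.PosDef) : ∃ (q : ℝ) (r : Fin d → ℝ) (R : Matrix (Fin d) (Fin d) ℝ),
      Q.submatrix (finSuccSumEquiv d) (finSuccSumEquiv d) = borderedMatrix q r R ∧
        0 < q ∧ R.PosDef ∧ Q.det = q * R.det := by
  obtain ⟨R, hR⟩ : ∃ R, R = Q.submatrix Fin.succ Fin.succ - (Q 0 0)⁻¹ •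
      Matrix.vecMulVec (fun i => Q 0 (Fin.succ i)) (fun i => Q 0 (Fin.succ i)) := ⟨_, rfl⟩
  have heq : Q.submatrix (finSuccSumEquiv d) (finSuccSumEquiv d) =
      borderedMatrix (Q 0 0) (fun i => Q 0 (Fin.succ i)) R := by
    ext i j
    rcases i with i | i <;> rcases j with j | j <;> simp [borderedMatrix, hR]
    simpa using (hQ.isHermitian.apply (Fin.succ i) 0).symm
  have hpd : (borderedMatrix (Q 0 0) (fun i => Q 0 (Fin.succ i)) R).PosDef :=
    heq ▸ hQ.submatrix (finSuccSumEquiv d).injective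
  obtain ⟨hq, hRpd⟩ := (posDef_borderedMatrix_iff _ _).mp hpd
  refine ⟨_, _, R, heq, hq, hRpd, ?_⟩
  rw [← det_borderedMatrix hq.ne' (fun i => Q 0 (Fin.succ i)), ← heq,
    Matrix.det_submatrix_equiv_self]

/-! ### The normalizing constant of the inverted Wishart density -/

open Classical in
/-- The inverted Wishart density without its normalizing constant. -/
noncomputable def invWishartKernel {d : ℕ} (Q : Matrix (Fin d) (Fin d) ℝ) (n : ℝ)
    (v : Sym2 (Fin d) → ℝ) : ENNReal :=
  if (symMatrix v).PosDef then
    ENNReal.ofReal (Real.exp (-(n + d + 1) / 2 * Real.log (symMatrix v).det -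
      1 / 2 * ((symMatrix v)⁻¹ * Q).trace))
  else 0

theorem measurable_invWishartKernel {d : ℕ} (Q : Matrix (Fin d) (Fin d) ℝ) (n : ℝ) :
    Measurable (invWishartKernel Q n) := by
  unfold invWishartKernel
  refine Measurable.ite (measurableSet_posDef_symMatrix d) ?_ measurable_const
  have h1 := measurable_det_symMatrix d
  have h2 : Measurable fun v : Sym2 (Fin d) → ℝ => ((symMatrix v)⁻¹ * Q).trace := by
    simp only [Matrix.trace, Matrix.diag_apply, Matrix.mul_apply]
    exact Finset.measurable_sum _ fun i _ => Finset.measurable_sum _ fun j _ =>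
      (measurable_inv_symMatrix_apply i j).mul_const _
  exact (((Real.measurable_log.comp h1).const_mul _).sub (h2.const_mul _)).exp.ennreal_ofReal

theorem invWishartKernel_glueSym {d : ℕ} {Q : Matrix (Fin (d + 1)) (Fin (d + 1)) ℝ} {n q : ℝ}
    {r : Fin d → ℝ} {R : Matrix (Fin d) (Fin d) ℝ}
    (hQ : Q.submatrix (finSuccSumEquiv d) (finSuccSumEquiv d) = borderedMatrix q r R)
    (hq : 0 < q) {a : ℝ} (ha : 0 < a) (b : Fin d → ℝ) {s : Sym2 (Fin d) → ℝ}
    (hs : (symMatrix s).PosDef) :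
    invWishartKernel Q n (glueSym a b (s + a⁻¹ • rankOneSym b)) =
      ENNReal.ofReal (Real.exp (-(n + d + 2) / 2 * (Real.log a + Real.log (symMatrix s).det) -
        q / (2 * a) - 1 / 2 * ((symMatrix s)⁻¹ * R).trace)) *
      ENNReal.ofReal (Real.exp (-(1 / 2) * ((b - (a / q) • r) ⬝ᵥ
        (((q / a ^ 2) • (symMatrix s)⁻¹) *ᵥ (b - (a / q) • r))))) := by
  have hsub := submatrix_symMatrix_glueSym a b s
  have hpd : (symMatrix (glueSym a b (s + a⁻¹ • rankOneSym b))).PosDef := by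
    have h := (posDef_borderedMatrix_iff b (symMatrix s)).mpr ⟨ha, hs⟩
    rw [← hsub] at h
    simpa using h.submatrix (finSuccSumEquiv d).symm.injective
  have hdet : (symMatrix (glueSym a b (s + a⁻¹ • rankOneSym b))).det = a * (symMatrix s).det := by
    rw [← det_borderedMatrix ha.ne' b, ← hsub, Matrix.det_submatrix_equiv_self]
  have hsymm : (symMatrix s)⁻¹.IsSymm := by
    have := hs.inv.isHermitian
    rwa [Matrix.IsHermitian, Matrix.conjTranspose_eq_transpose_of_trivial] at this
  have htr : ((symMatrix (glueSym a b (s + a⁻¹ • rankOneSym b)))⁻¹ * Q).trace =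
      ((borderedMatrix a b (symMatrix s))⁻¹ * borderedMatrix q r R).trace := by
    rw [← hsub, ← hQ, Matrix.inv_submatrix_equiv, Matrix.submatrix_mul_equiv]
    exact ((finSuccSumEquiv d).sum_comp fun i =>
      ((symMatrix (glueSym a b (s + a⁻¹ • rankOneSym b)))⁻¹ * Q) i i).symm
  rw [invWishartKernel, if_pos hpd, ← ENNReal.ofReal_mul (Real.exp_pos _).le, ← Real.exp_add,
    hdet, htr, trace_inv_borderedMatrix_mul ha.ne' hq.ne' b r hs.det_pos.ne'.isUnit hsymm,
    Real.log_mul ha.ne' hs.det_pos.ne']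
  congr 2
  push_cast
  field_simp
  ring

theorem invWishartKernel_glueSym_eq_zero {d : ℕ} (Q : Matrix (Fin (d + 1)) (Fin (d + 1)) ℝ)
    (n : ℝ) {a : ℝ} (b : Fin d → ℝ) {s : Sym2 (Fin d) → ℝ}
    (h : ¬ (0 < a ∧ (symMatrix s).PosDef)) :
    invWishartKernel Q n (glueSym a b (s + a⁻¹ • rankOneSym b)) = 0 := by
  refine if_neg fun hpd => h ?_
  rw [← posDef_borderedMatrix_iff b, ← submatrix_symMatrix_glueSym]
  exact hpd.submatrix (finSuccSumEquiv d).injective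

theorem wishartZ_pos {n : ℝ} {d : ℕ} (hn : (d : ℝ) - 1 < n) : 0 < wishartZ n d := by
  refine mul_pos (Real.rpow_pos_of_pos Real.pi_pos _) (Finset.prod_pos fun i hi => ?_)
  have : (i : ℝ) ≤ d := by exact_mod_cast (Finset.mem_Icc.mp hi).2
  exact Real.Gamma_pos_of_pos (by linarith)

/-- In the induction, π^(d/2) is supplied by the Gaussian integral over the border and Γ((n-d)/2) by
the inverse gamma integral over the corner. -/
theorem log_wishartZ_succ {n : ℝ} {d : ℕ} (hn : (d : ℝ) < n) :
    Real.log (wishartZ n (d + 1)) = Real.log (wishartZ n d) +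
      (d : ℝ) / 2 * Real.log Real.pi + Real.log (Real.Gamma ((n - d) / 2)) := by
  have hG : 0 < Real.Gamma ((n - d) / 2) := Real.Gamma_pos_of_pos (by linarith)
  have h : wishartZ n (d + 1) =
      wishartZ n d * (Real.pi ^ ((d : ℝ) / 2) * Real.Gamma ((n - d) / 2)) := by
    rw [wishartZ, wishartZ, Finset.prod_Icc_succ_top (by omega),
      show ((d + 1 : ℕ) : ℝ) * (((d + 1 : ℕ) : ℝ) - 1) / 4 =
        (d : ℝ) * ((d : ℝ) - 1) / 4 + (d : ℝ) / 2 by push_cast; ring,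
      Real.rpow_add Real.pi_pos, show (n + 1 - ((d + 1 : ℕ) : ℝ)) / 2 = (n - d) / 2 by
        push_cast; ring]
    ring
  rw [h, Real.log_mul (wishartZ_pos (by linarith)).ne' (by positivity),
    Real.log_mul (by positivity) hG.ne', Real.log_rpow Real.pi_pos]
  ring

/-- The integral over the border and the corner of the inverted Wishart kernel, for a fixed Schur
complement. -/
theorem lintegral_border_invWishartKernel {d : ℕ} {Q : Matrix (Fin (d + 1)) (Fin (d + 1)) ℝ}
    {n q : ℝ} {r : Fin d → ℝ} {R : Matrix (Fin d) (Fin d) ℝ}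
    (hQ : Q.submatrix (finSuccSumEquiv d) (finSuccSumEquiv d) = borderedMatrix q r R)
    (hq : 0 < q) {a : ℝ} (ha : 0 < a) (s : Sym2 (Fin d) → ℝ) :
    ∫⁻ b : Fin d → ℝ, invWishartKernel Q n (glueSym a b (s + a⁻¹ • rankOneSym b)) =
      ENNReal.ofReal (Real.exp (-((n - d) / 2 + 1) * Real.log a - (q / 2) / a +
        ((d : ℝ) / 2 * Real.log (2 * Real.pi) - d / 2 * Real.log q))) *
      invWishartKernel R n s := by
  by_cases hs : (symMatrix s).PosDef
  · have hP : ((q / a ^ 2) • (symMatrix s)⁻¹).PosDef := hs.inv.smul (by positivity)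
    -- The Gaussian integral contributes a^d |S|^(1/2). This turns the exponent -(n+d+2)/2 into
    -- -((n-d)/2+1) for a and into -(n+d+1)/2 for |S|, the kernel of size d with the same n.
    have hdet : Real.log ((q / a ^ 2) • (symMatrix s)⁻¹).det =
        d * Real.log q - 2 * d * Real.log a - Real.log (symMatrix s).det := by
      have h0 := hs.det_pos
      rw [Matrix.det_smul, Matrix.det_nonsing_inv, Ring.inverse_eq_inv', Fintype.card_fin,
        Real.log_mul (by positivity) (by positivity), Real.log_pow, Real.log_div (by positivity)
        (by positivity), Real.log_pow, Real.log_inv]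
      push_cast
      ring
    simp_rw [invWishartKernel_glueSym hQ hq ha _ hs]
    rw [lintegral_const_mul' _ _ ENNReal.ofReal_ne_top,
      lintegral_sub_right_eq_self (μ := (volume : Measure (Fin d → ℝ)))
        (fun b => ENNReal.ofReal (Real.exp (-(1 / 2) *
          (b ⬝ᵥ (((q / a ^ 2) • (symMatrix s)⁻¹) *ᵥ b))))) ((a / q) • r),
      lintegral_exp_neg_half_quadratic hP, invWishartKernel, if_pos hs, hdet,
      ← ENNReal.ofReal_mul (Real.exp_pos _).le, ← ENNReal.ofReal_mul (Real.exp_pos _).le,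
      ← Real.exp_add, ← Real.exp_add, Fintype.card_fin]
    congr 2
    field_simp
    ring
  · simp_rw [invWishartKernel_glueSym_eq_zero Q n _ fun h : 0 < a ∧ _ => hs h.2]
    rw [lintegral_zero, invWishartKernel, if_neg hs, mul_zero]

/-- The normalizing constant of the inverted Wishart distribution. -/
theorem lintegral_invWishartKernel {d : ℕ} {Q : Matrix (Fin d) (Fin d) ℝ} {n : ℝ}
    (hQ : Q.PosDef) (hn : (d : ℝ) - 1 < n) :
    ∫⁻ v, invWishartKernel Q n v = ENNReal.ofReal (Real.exp (n * d / 2 * Real.log 2 +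
      Real.log (wishartZ n d) - n / 2 * Real.log Q.det)) := by
  induction d with
  | zero =>
    have h1 : ∀ v : Sym2 (Fin 0) → ℝ, invWishartKernel Q n v = 1 := by
      -- In size 0 the space of coordinates is a point of mass one, and the empty matrix is positive
      -- definite with determinant 1.
      intro v
      have : (symMatrix v).PosDef := by
        rw [Subsingleton.elim (symMatrix v) 1]
        exact Matrix.PosDef.one
      rw [invWishartKernel, if_pos this]
      simp
    simp_rw [h1]
    simp [wishartZ, volume_pi]
  | succ d ih =>
    obtain ⟨q, r, R, hsub, hq, hR, hdet⟩ := exists_submatrix_eq_borderedMatrix hQ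
    have hn' : (d : ℝ) < n := by push_cast at hn; linarith
    have hmeas := measurable_invWishartKernel Q n
    have hjoint : ∀ a : ℝ, Measurable fun t : (Fin d → ℝ) × (Sym2 (Fin d) → ℝ) =>
        invWishartKernel Q n (glueSym a t.1 (t.2 + a⁻¹ • rankOneSym t.1)) := fun a => by
      have hr := measurable_rankOneSym d
      have h : Measurable fun t : (Fin d → ℝ) × (Sym2 (Fin d) → ℝ) =>
          (a, t.1, t.2 + a⁻¹ • rankOneSym t.1) := by fun_prop
      exact hmeas.comp ((measurable_glueSym d).comp h)
    have hinner : ∀ a : ℝ, ∫⁻ b : Fin d → ℝ, ∫⁻ c : Sym2 (Fin d) → ℝ,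
        invWishartKernel Q n (glueSym a b c) =
        (Set.Ioi (0 : ℝ)).indicator (fun a => ENNReal.ofReal (Real.exp
          (-((n - d) / 2 + 1) * Real.log a - (q / 2) / a)) * ENNReal.ofReal (Real.exp
            ((d : ℝ) / 2 * Real.log (2 * Real.pi) - d / 2 * Real.log q +
              (n * d / 2 * Real.log 2 + Real.log (wishartZ n d) - n / 2 * Real.log R.det)))) a := by
      intro a
      have hshift : ∀ b : Fin d → ℝ, ∫⁻ c : Sym2 (Fin d) → ℝ,
          invWishartKernel Q n (glueSym a b c) = ∫⁻ s : Sym2 (Fin d) → ℝ,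
            invWishartKernel Q n (glueSym a b (s + a⁻¹ • rankOneSym b)) := fun b =>
        (lintegral_add_right_eq_self (μ := (volume : Measure (Sym2 (Fin d) → ℝ)))
          (fun c => invWishartKernel Q n (glueSym a b c)) _).symm
      simp_rw [hshift]
      by_cases ha : 0 < a
      -- The border is integrated first, for a fixed Schur complement; what remains is the kernel of
      -- size d.
      · rw [lintegral_lintegral_swap (hjoint a).aemeasurable]
        simp_rw [lintegral_border_invWishartKernel hsub hq ha]
        rw [lintegral_const_mul' _ _ ENNReal.ofReal_ne_top, ih hR (by linarith),
          Set.indicator_of_mem (Set.mem_Ioi.mpr ha), ← ENNReal.ofReal_mul (Real.exp_pos _).le,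
          ← ENNReal.ofReal_mul (Real.exp_pos _).le, ← Real.exp_add, ← Real.exp_add]
        congr 2
        ring
      · simp_rw [invWishartKernel_glueSym_eq_zero Q n _ fun h => ha (And.left h)]
        rw [lintegral_zero, lintegral_zero, Set.indicator_of_notMem (by simpa using ha)]
    rw [lintegral_sym2_succ hmeas]
    simp_rw [hinner]
    rw [lintegral_indicator measurableSet_Ioi, lintegral_mul_const' _ _ ENNReal.ofReal_ne_top,
      lintegral_inverse_gamma (by linarith) (by linarith), ← ENNReal.ofReal_mul (Real.exp_pos _).le,
      ← Real.exp_add, hdet, log_wishartZ_succ hn', Real.log_mul hq.ne' hR.det_pos.ne',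
      Real.log_mul two_ne_zero Real.pi_ne_zero, Real.log_div hq.ne' two_ne_zero]
    congr 2
    push_cast
    ring

/-! ### The prior density: exponential form and total mass -/

/-- The logarithm of the normalizing constant of the prior density. -/
noncomputable def logPriorConst {d m : ℕ} (K : Matrix (Fin m) (Fin m) ℝ)
    (Q : Matrix (Fin d) (Fin d) ℝ) (n : ℝ) : ℝ :=
  (d : ℝ) / 2 * Real.log K.det + n / 2 * Real.log Q.det - n * d / 2 * Real.log 2 -
    (d : ℝ) * m / 2 * Real.log (2 * Real.pi) - Real.log (wishartZ n d)

/-- The exponent of the prior density, up to the factor `-1/2`. -/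
noncomputable def priorExponent {d m : ℕ} (M : Matrix (Fin d) (Fin m) ℝ)
    (K : Matrix (Fin m) (Fin m) ℝ) (Q : Matrix (Fin d) (Fin d) ℝ) (θ : Param d m) : ℝ :=
  ((θ.coeff - M)ᵀ * θ.cov⁻¹ * (θ.coeff - M) * K).trace + (θ.cov⁻¹ * Q).trace

theorem log_det_smul {d : ℕ} {c : ℝ} (hc : 0 < c) {V : Matrix (Fin d) (Fin d) ℝ}
    (hV : V.PosDef) : Real.log (c • V).det = d * Real.log c + Real.log V.det := by
  have := hV.det_pos
  rw [Matrix.det_smul, Fintype.card_fin, Real.log_mul (by positivity) (by positivity),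
    Real.log_pow]

theorem det_two_pi_smul_pos {d : ℕ} {V : Matrix (Fin d) (Fin d) ℝ} (hV : V.PosDef) :
    0 < ((2 * Real.pi) • V).det :=
  (hV.smul (by positivity)).det_pos

theorem priorDensity_of_posDef {d m : ℕ} (M : Matrix (Fin d) (Fin m) ℝ)
    {K : Matrix (Fin m) (Fin m) ℝ} {Q : Matrix (Fin d) (Fin d) ℝ} {n : ℝ} (hK : K.PosDef)
    (hQ : Q.PosDef) (hn : (d : ℝ) - 1 < n) {θ : Param d m} (hθ : θ.cov.PosDef) :
    priorDensity M K Q n θ = Real.exp (logPriorConst K Q n -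
      (n + d + 1 + m) / 2 * Real.log θ.cov.det - 1 / 2 * priorExponent M K Q θ) := by
  have hVd := hθ.det_pos
  have hKd := hK.det_pos
  have hQd := hQ.det_pos
  have hZ := wishartZ_pos hn
  have h2V := det_two_pi_smul_pos hθ
  have hdet : ((1 / 2 : ℝ) • (θ.cov⁻¹ * Q)).det = (1 / 2) ^ d * (θ.cov.det⁻¹ * Q.det) := by
    rw [Matrix.det_smul, Matrix.det_mul, Matrix.det_nonsing_inv, Ring.inverse_eq_inv',
      Fintype.card_fin]
  have hdet' : 0 < ((1 / 2 : ℝ) • (θ.cov⁻¹ * Q)).det := by rw [hdet]; positivity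
  have hlog : Real.log ((1 / 2 : ℝ) • (θ.cov⁻¹ * Q)).det =
      -d * Real.log 2 - Real.log θ.cov.det + Real.log Q.det := by
    rw [hdet, Real.log_mul (by positivity) (by positivity), Real.log_mul (by positivity)
      (by positivity), Real.log_pow, Real.log_inv, one_div, Real.log_inv]
    ring
  rw [priorDensity, matrixNormalDensity, invWishartDensity, if_pos hθ,
    Real.rpow_def_of_pos hKd, Real.rpow_def_of_pos h2V, Real.rpow_def_of_pos hVd,
    Real.rpow_def_of_pos hdet', hlog, log_det_smul Real.two_pi_pos hθ, div_eq_mul_inv, ← Real.exp_neg,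
    one_div (wishartZ n d), one_div (Real.exp _), ← Real.exp_neg]
  nth_rw 1 [← Real.exp_log (inv_pos.mpr hZ)]
  simp only [← Real.exp_add]
  rw [Real.log_inv, logPriorConst, priorExponent]
  congr 1
  ring

theorem priorDensity_of_not_posDef {d m : ℕ} (M : Matrix (Fin d) (Fin m) ℝ)
    (K : Matrix (Fin m) (Fin m) ℝ) (Q : Matrix (Fin d) (Fin d) ℝ) (n : ℝ) {θ : Param d m}
    (hθ : ¬ θ.cov.PosDef) : priorDensity M K Q n θ = 0 := by
  rw [priorDensity, invWishartDensity, if_neg hθ, mul_zero]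

theorem priorDensity_nonneg {d m : ℕ} (M : Matrix (Fin d) (Fin m) ℝ)
    {K : Matrix (Fin m) (Fin m) ℝ} {Q : Matrix (Fin d) (Fin d) ℝ} {n : ℝ} (hK : K.PosDef)
    (hQ : Q.PosDef) (hn : (d : ℝ) - 1 < n) (θ : Param d m) : 0 ≤ priorDensity M K Q n θ := by
  by_cases hθ : θ.cov.PosDef
  · rw [priorDensity_of_posDef M hK hQ hn hθ]
    exact (Real.exp_pos _).le
  · rw [priorDensity_of_not_posDef M K Q n hθ]

section Measurability

variable {α : Type*} [MeasurableSpace α] {ι κ μ : Type*}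

theorem measurable_mul_apply [Fintype κ] {f : α → Matrix ι κ ℝ} {g : α → Matrix κ μ ℝ}
    (hf : ∀ i j, Measurable fun x => f x i j) (hg : ∀ i j, Measurable fun x => g x i j)
    (i : ι) (j : μ) : Measurable fun x => (f x * g x) i j := by
  simp only [Matrix.mul_apply]
  exact Finset.measurable_sum _ fun k _ => (hf i k).mul (hg k j)

theorem measurable_trace [Fintype ι] {f : α → Matrix ι ι ℝ}
    (hf : ∀ i j, Measurable fun x => f x i j) : Measurable fun x => (f x).trace :=
  Finset.measurable_sum _ fun i _ => hf i i

end Measurability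

theorem measurableSet_posDef_cov (d m : ℕ) : MeasurableSet {θ : Param d m | θ.cov.PosDef} :=
  measurable_snd (measurableSet_posDef_symMatrix d)

theorem measurable_inv_cov_apply {d m : ℕ} (i j : Fin d) :
    Measurable fun θ : Param d m => θ.cov⁻¹ i j :=
  (measurable_inv_symMatrix_apply i j).comp measurable_snd

theorem measurable_det_cov (d m : ℕ) : Measurable fun θ : Param d m => θ.cov.det :=
  (measurable_det_symMatrix d).comp measurable_snd

theorem measurable_coeff_apply {d m : ℕ} (i : Fin d) (j : Fin m) :
    Measurable fun θ : Param d m => θ.coeff i j :=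
  (measurable_pi_apply j).comp ((measurable_pi_apply i).comp measurable_fst)

theorem measurable_priorExponent {d m : ℕ} (M : Matrix (Fin d) (Fin m) ℝ)
    (K : Matrix (Fin m) (Fin m) ℝ) (Q : Matrix (Fin d) (Fin d) ℝ) :
    Measurable (priorExponent M K Q) := by
  have h1 : ∀ i j, Measurable fun θ : Param d m => (θ.coeff - M) i j := fun i j =>
    (measurable_coeff_apply i j).sub_const _
  have h2 : ∀ i j, Measurable fun θ : Param d m => (θ.coeff - M)ᵀ i j := fun i j => h1 j i
  have h3 := measurable_mul_apply h2 measurable_inv_cov_apply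
  have h4 := measurable_mul_apply h3 h1
  have h5 := measurable_mul_apply h4 (g := fun _ => K) fun _ _ => measurable_const
  have h6 := measurable_mul_apply (measurable_inv_cov_apply (d := d) (m := m)) (g := fun _ => Q)
    fun _ _ => measurable_const
  exact (measurable_trace h5).add (measurable_trace h6)

theorem measurable_priorDensity {d m : ℕ} (M : Matrix (Fin d) (Fin m) ℝ)
    {K : Matrix (Fin m) (Fin m) ℝ} {Q : Matrix (Fin d) (Fin d) ℝ} {n : ℝ} (hK : K.PosDef)
    (hQ : Q.PosDef) (hn : (d : ℝ) - 1 < n) : Measurable (priorDensity M K Q n) := by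
  classical
  have h : priorDensity M K Q n = fun θ => if θ.cov.PosDef then Real.exp (logPriorConst K Q n -
      (n + d + 1 + m) / 2 * Real.log θ.cov.det - 1 / 2 * priorExponent M K Q θ) else 0 := by
    funext θ
    split_ifs with hθ
    · exact priorDensity_of_posDef M hK hQ hn hθ
    · exact priorDensity_of_not_posDef M K Q n hθ
  rw [h]
  exact Measurable.ite (measurableSet_posDef_cov d m)
    (((measurable_const.sub ((Real.measurable_log.comp (measurable_det_cov d m)).const_mul _)).sub
      ((measurable_priorExponent M K Q).const_mul _)).exp) measurable_const

/-- The prior density integrates to one. -/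
theorem lintegral_priorDensity {d m : ℕ} (M : Matrix (Fin d) (Fin m) ℝ)
    {K : Matrix (Fin m) (Fin m) ℝ} {Q : Matrix (Fin d) (Fin d) ℝ} {n : ℝ} (hK : K.PosDef)
    (hQ : Q.PosDef) (hn : (d : ℝ) - 1 < n) :
    ∫⁻ θ : Param d m, ENNReal.ofReal (priorDensity M K Q n θ) = 1 := by
  have hmeas := (measurable_priorDensity M hK hQ hn).ennreal_ofReal
  have hinner : ∀ v : Sym2 (Fin d) → ℝ,
      ∫⁻ A : Fin d → Fin m → ℝ, ENNReal.ofReal (priorDensity M K Q n (A, v)) =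
        ENNReal.ofReal (Real.exp (n / 2 * Real.log Q.det - n * d / 2 * Real.log 2 -
          Real.log (wishartZ n d))) * invWishartKernel Q n v := by
    intro v
    by_cases hv : (symMatrix v).PosDef
    · have hsplit : ∀ A : Fin d → Fin m → ℝ, ENNReal.ofReal (priorDensity M K Q n (A, v)) =
          ENNReal.ofReal (Real.exp (logPriorConst K Q n - (n + d + 1 + m) / 2 *
            Real.log (symMatrix v).det - 1 / 2 * ((symMatrix v)⁻¹ * Q).trace)) *
          ENNReal.ofReal (Real.exp (-(1 / 2) *
            ((Matrix.of A - M)ᵀ * (symMatrix v)⁻¹ * (Matrix.of A - M) * K).trace)) := by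
        intro A
        have hθ : (Param.cov ((A, v) : Param d m)).PosDef := hv
        rw [priorDensity_of_posDef M hK hQ hn hθ, ← ENNReal.ofReal_mul (Real.exp_pos _).le,
          ← Real.exp_add]
        simp only [priorExponent, Param.cov, Param.coeff]
        congr 2
        ring
      simp_rw [hsplit]
      rw [lintegral_const_mul' _ _ ENNReal.ofReal_ne_top, lintegral_matrixNormal_kernel M hv hK,
        invWishartKernel, if_pos hv, ← ENNReal.ofReal_mul (Real.exp_pos _).le,
        ← ENNReal.ofReal_mul (Real.exp_pos _).le, ← Real.exp_add, ← Real.exp_add, logPriorConst]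
      congr 2
      ring
    · have hzero : ∀ A : Fin d → Fin m → ℝ, priorDensity M K Q n (A, v) = 0 := fun A =>
        priorDensity_of_not_posDef M K Q n hv
      simp [hzero, invWishartKernel, hv]
  -- The integral over A is the inner one. Its value contains |V|^(m/2), which cancels the extra
  -- power of |V| and leaves the inverted Wishart kernel.
  refine (lintegral_prod_symm' _ hmeas).trans ?_
  simp_rw [hinner]
  rw [lintegral_const_mul' _ _ ENNReal.ofReal_ne_top, lintegral_invWishartKernel hQ hn,
    ← ENNReal.ofReal_mul (Real.exp_pos _).le, ← Real.exp_add, ← ENNReal.ofReal_one,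
    ← Real.exp_zero]
  congr 2
  ring

theorem integrable_priorDensity {d m : ℕ} (M : Matrix (Fin d) (Fin m) ℝ)
    {K : Matrix (Fin m) (Fin m) ℝ} {Q : Matrix (Fin d) (Fin d) ℝ} {n : ℝ} (hK : K.PosDef)
    (hQ : Q.PosDef) (hn : (d : ℝ) - 1 < n) : Integrable (priorDensity M K Q n) := by
  refine ⟨(measurable_priorDensity M hK hQ hn).aestronglyMeasurable, ?_⟩
  rw [hasFiniteIntegral_iff_ofReal (.of_forall (priorDensity_nonneg M hK hQ hn)),
    lintegral_priorDensity M hK hQ hn]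
  exact ENNReal.one_lt_top

theorem integral_priorDensity {d m : ℕ} (M : Matrix (Fin d) (Fin m) ℝ)
    {K : Matrix (Fin m) (Fin m) ℝ} {Q : Matrix (Fin d) (Fin d) ℝ} {n : ℝ} (hK : K.PosDef)
    (hQ : Q.PosDef) (hn : (d : ℝ) - 1 < n) : ∫ θ, priorDensity M K Q n θ = 1 := by
  rw [integral_eq_lintegral_of_nonneg_ae (.of_forall (priorDensity_nonneg M hK hQ hn))
    (measurable_priorDensity M hK hQ hn).aestronglyMeasurable, lintegral_priorDensity M hK hQ hn]
  simp

/-! ### Conjugacy: the posterior belongs to the family of priors -/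

section Update

variable {d m : ℕ} (M : Matrix (Fin d) (Fin m) ℝ) (K : Matrix (Fin m) (Fin m) ℝ)
  (Q : Matrix (Fin d) (Fin d) ℝ) (x : Fin m → ℝ) (y : Fin d → ℝ)

/-- The parameter `K` of the posterior. -/
def updateK : Matrix (Fin m) (Fin m) ℝ := Matrix.vecMulVec x x + K

/-- The factor `|K| / |xxᵀ + K|` that rescales the prediction error. -/
noncomputable def shrink : ℝ := 1 - x ⬝ᵥ ((updateK K x)⁻¹ *ᵥ x)

/-- The parameter `M` of the posterior. -/
noncomputable def updateM : Matrix (Fin d) (Fin m) ℝ :=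
  M + Matrix.vecMulVec (y - M *ᵥ x) ((updateK K x)⁻¹ *ᵥ x)

/-- The parameter `Q` of the posterior. -/
noncomputable def updateQ : Matrix (Fin d) (Fin d) ℝ :=
  Q + shrink K x • Matrix.vecMulVec (y - M *ᵥ x) (y - M *ᵥ x)

end Update

theorem posSemidef_vecMulVec_self {ι : Type*} [Finite ι] (x : ι → ℝ) :
    (Matrix.vecMulVec x x).PosSemidef := by
  simpa using Matrix.posSemidef_vecMulVec_self_star x

theorem posDef_updateK {m : ℕ} {K : Matrix (Fin m) (Fin m) ℝ} (hK : K.PosDef) (x : Fin m → ℝ) :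
    (updateK K x).PosDef :=
  hK.posSemidef_add (posSemidef_vecMulVec_self x)

/-- Matrix determinant lemma for K = K' - xxᵀ. It yields both the positivity of `shrink` and its
logarithm. -/
theorem det_eq_shrink_mul {m : ℕ} {K : Matrix (Fin m) (Fin m) ℝ} (hK : K.PosDef)
    (x : Fin m → ℝ) : K.det = (updateK K x).det * shrink K x := by
  have h := Matrix.det_add_replicateCol_mul_replicateRow (ι := Unit)
    (posDef_updateK hK x).det_pos.ne'.isUnit (-x) x
  have h1 : updateK K x + Matrix.replicateCol Unit (-x) * Matrix.replicateRow Unit x = K := by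
    rw [← Matrix.vecMulVec_eq, updateK, Matrix.neg_vecMulVec]
    abel
  rw [h1] at h
  rw [h, Matrix.det_unique (1 + Matrix.replicateRow Unit x * (updateK K x)⁻¹ *
      Matrix.replicateCol Unit (-x)), Matrix.add_apply, Matrix.one_apply_eq, Matrix.mul_assoc,
    ← Matrix.replicateCol_mulVec, Matrix.replicateRow_mul_replicateCol_apply, Matrix.mulVec_neg,
    dotProduct_neg, shrink, sub_eq_add_neg]

theorem shrink_pos {m : ℕ} {K : Matrix (Fin m) (Fin m) ℝ} (hK : K.PosDef) (x : Fin m → ℝ) :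
    0 < shrink K x :=
  pos_of_mul_pos_right (det_eq_shrink_mul hK x ▸ hK.det_pos) (posDef_updateK hK x).det_pos.le

theorem log_shrink {m : ℕ} {K : Matrix (Fin m) (Fin m) ℝ} (hK : K.PosDef) (x : Fin m → ℝ) :
    Real.log (shrink K x) = Real.log K.det - Real.log (updateK K x).det := by
  rw [det_eq_shrink_mul hK x, Real.log_mul (posDef_updateK hK x).det_pos.ne' (shrink_pos hK x).ne']
  ring

theorem posDef_updateQ {d m : ℕ} (M : Matrix (Fin d) (Fin m) ℝ) {K : Matrix (Fin m) (Fin m) ℝ}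
    {Q : Matrix (Fin d) (Fin d) ℝ} (hK : K.PosDef) (hQ : Q.PosDef) (x : Fin m → ℝ)
    (y : Fin d → ℝ) : (updateQ M K Q x y).PosDef :=
  hQ.add_posSemidef ((posSemidef_vecMulVec_self _).smul (shrink_pos hK x).le)

theorem trace_vecMulVec_mul {ι κ : Type*} [Fintype ι] [Fintype κ] (a : ι → ℝ) (b : κ → ℝ)
    (N : Matrix κ ι ℝ) : (Matrix.vecMulVec a b * N).trace = b ⬝ᵥ (N *ᵥ a) := by
  rw [Matrix.vecMulVec_mul, Matrix.trace_vecMulVec, dotProduct_comm, Matrix.dotProduct_mulVec]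

/-- Completing the square in the exponent of the joint density. -/
theorem quadratic_add_priorExponent {d m : ℕ} (M : Matrix (Fin d) (Fin m) ℝ)
    {K : Matrix (Fin m) (Fin m) ℝ} (Q : Matrix (Fin d) (Fin d) ℝ) (hK : K.PosDef)
    (x : Fin m → ℝ) (y : Fin d → ℝ) {θ : Param d m} (hθ : θ.cov.PosDef) :
    (y - θ.coeff *ᵥ x) ⬝ᵥ (θ.cov⁻¹ *ᵥ (y - θ.coeff *ᵥ x)) + priorExponent M K Q θ =
      priorExponent (updateM M K x y) (updateK K x) (updateQ M K Q x y) θ := by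
  obtain ⟨P, hP⟩ : ∃ P, P = θ.cov⁻¹ := ⟨_, rfl⟩
  obtain ⟨D, hD⟩ : ∃ D, D = θ.coeff - M := ⟨_, rfl⟩
  obtain ⟨z, hz⟩ : ∃ z, z = y - M *ᵥ x := ⟨_, rfl⟩
  obtain ⟨u, hu⟩ : ∃ u, u = (updateK K x)⁻¹ *ᵥ x := ⟨_, rfl⟩
  have hPs : Pᵀ = P := by
    have := hθ.inv.isHermitian
    rwa [Matrix.IsHermitian, Matrix.conjTranspose_eq_transpose_of_trivial, ← hP] at this
  have hKu : updateK K x *ᵥ u = x := by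
    rw [hu, Matrix.mulVec_mulVec, Matrix.mul_nonsing_inv _
      (posDef_updateK hK x).det_pos.ne'.isUnit, Matrix.one_mulVec]
  have hKs : (updateK K x)ᵀ = updateK K x := by
    have := (posDef_updateK hK x).isHermitian
    rwa [Matrix.IsHermitian, Matrix.conjTranspose_eq_transpose_of_trivial] at this
  have hw : y - θ.coeff *ᵥ x = z - D *ᵥ x := by
    rw [hz, hD, Matrix.sub_mulVec]
    abel
  have hD' : θ.coeff - updateM M K x y = D - Matrix.vecMulVec z u := by
    rw [updateM, ← hz, ← hu, hD]
    abel
  have hsymm : ∀ a b : Fin d → ℝ, a ⬝ᵥ (P *ᵥ b) = b ⬝ᵥ (P *ᵥ a) := fun a b => by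
    rw [Matrix.dotProduct_mulVec, ← Matrix.mulVec_transpose, hPs, dotProduct_comm]
  have huK : u ᵥ* updateK K x = x := by rw [← Matrix.mulVec_transpose, hKs, hKu]
  -- Since K'u = x, expanding the trace for D - zuᵀ against K' gives the old trace plus (Dx)ᵀP(Dx) -
  -- 2zᵀP(Dx) + (xᵀu) zᵀPz. The new Q adds (1 - xᵀu) zᵀPz, which completes the form of z - Dx.
  have t1 : (Dᵀ * P * D * updateK K x).trace =
      (Dᵀ * P * D * K).trace + (D *ᵥ x) ⬝ᵥ (P *ᵥ (D *ᵥ x)) := by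
    rw [updateK, Matrix.mul_add, Matrix.trace_add, add_comm,
      Matrix.trace_mul_comm _ (Matrix.vecMulVec x x), trace_vecMulVec_mul, ← Matrix.mulVec_mulVec, ← Matrix.mulVec_mulVec, Matrix.dotProduct_mulVec,
      Matrix.vecMul_transpose]
  have t2 : ((Matrix.vecMulVec z u)ᵀ * P * D * updateK K x).trace = z ⬝ᵥ (P *ᵥ (D *ᵥ x)) := by
    rw [Matrix.transpose_vecMulVec, Matrix.mul_assoc, Matrix.mul_assoc, trace_vecMulVec_mul,
      ← Matrix.mulVec_mulVec, ← Matrix.mulVec_mulVec, hKu]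
  have t3 : (Dᵀ * P * Matrix.vecMulVec z u * updateK K x).trace = z ⬝ᵥ (P *ᵥ (D *ᵥ x)) := by
    rw [Matrix.mul_assoc, Matrix.vecMulVec_mul, huK, Matrix.trace_mul_comm, trace_vecMulVec_mul,
      ← Matrix.mulVec_mulVec, Matrix.dotProduct_mulVec, Matrix.vecMul_transpose, hsymm]
  have t4 : ((Matrix.vecMulVec z u)ᵀ * P * Matrix.vecMulVec z u * updateK K x).trace =
      (z ⬝ᵥ (P *ᵥ z)) * (x ⬝ᵥ u) := by
    rw [Matrix.mul_assoc, Matrix.vecMulVec_mul, huK, Matrix.transpose_vecMulVec, Matrix.mul_assoc,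
      trace_vecMulVec_mul, ← Matrix.mulVec_mulVec, Matrix.vecMulVec_mulVec]
    simp [Matrix.mulVec_smul, dotProduct_smul, mul_comm]
  have t5 : (P * Matrix.vecMulVec z z).trace = z ⬝ᵥ (P *ᵥ z) := by
    rw [Matrix.trace_mul_comm, trace_vecMulVec_mul]
  rw [priorExponent, priorExponent, hw, hD', ← hD, ← hP, updateQ, ← hz, shrink, ← hu,
    Matrix.transpose_sub, Matrix.mul_add, Matrix.trace_add, Matrix.mul_smul, Matrix.trace_smul, t5]
  simp only [Matrix.sub_mul, Matrix.mul_sub, Matrix.trace_sub, t1, t2, t3, t4, Matrix.mulVec_sub,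
    sub_dotProduct, dotProduct_sub, smul_eq_mul, hsymm (D *ᵥ x) z]
  ring

/-- The logarithm of the predictive density. -/
noncomputable def logPredictive {d m : ℕ} (M : Matrix (Fin d) (Fin m) ℝ)
    (K : Matrix (Fin m) (Fin m) ℝ) (Q : Matrix (Fin d) (Fin d) ℝ) (n : ℝ) (x : Fin m → ℝ)
    (y : Fin d → ℝ) : ℝ :=
  logPriorConst K Q n - d / 2 * Real.log (2 * Real.pi) -
    logPriorConst (updateK K x) (updateQ M K Q x y) (n + 1)

section Posterior

variable {d m : ℕ} (M : Matrix (Fin d) (Fin m) ℝ) {K : Matrix (Fin m) (Fin m) ℝ}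
  {Q : Matrix (Fin d) (Fin d) ℝ} {n : ℝ} (hK : K.PosDef) (hQ : Q.PosDef)
  (hn : (d : ℝ) - 1 < n) (x : Fin m → ℝ) (y : Fin d → ℝ)

theorem normalDensity_of_posDef {d : ℕ} (μ : Fin d → ℝ) {V : Matrix (Fin d) (Fin d) ℝ}
    (hV : V.PosDef) (y : Fin d → ℝ) :
    normalDensity μ V y = Real.exp (-(d / 2 * Real.log (2 * Real.pi)) - 1 / 2 * Real.log V.det -
      1 / 2 * ((y - μ) ⬝ᵥ (V⁻¹ *ᵥ (y - μ)))) := by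
  rw [normalDensity, Real.rpow_def_of_pos (det_two_pi_smul_pos hV), log_det_smul Real.two_pi_pos hV,
    ← Real.exp_neg, ← Real.exp_add]
  congr 1
  ring

include hK hQ hn

/-- The likelihood adds its quadratic form to the exponent and a factor |V|^(-1/2), which raises n
to n + 1. Off the positive definite cone both sides vanish. -/
theorem jointDensity_eq (θ : Param d m) :
    jointDensity M K Q n x y θ = Real.exp (logPredictive M K Q n x y) *
      priorDensity (updateM M K x y) (updateK K x) (updateQ M K Q x y) (n + 1) θ := by
  by_cases hθ : θ.cov.PosDef
  · rw [jointDensity, priorDensity_of_posDef M hK hQ hn hθ, priorDensity_of_posDef _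
      (posDef_updateK hK x) (posDef_updateQ M hK hQ x y) (by linarith) hθ,
      ← quadratic_add_priorExponent M Q hK x y hθ, normalDensity_of_posDef _ hθ, logPredictive,
      ← Real.exp_add, ← Real.exp_add]
    congr 1
    ring
  · rw [jointDensity, priorDensity_of_not_posDef _ _ _ _ hθ, priorDensity_of_not_posDef _ _ _ _ hθ,
      mul_zero, mul_zero]

theorem predictiveDensity_eq :
    predictiveDensity M K Q n x y = Real.exp (logPredictive M K Q n x y) := by
  rw [predictiveDensity]
  simp_rw [jointDensity_eq M hK hQ hn x y]
  rw [integral_const_mul, integral_priorDensity _ (posDef_updateK hK x)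
    (posDef_updateQ M hK hQ x y) (by linarith), mul_one]

theorem posteriorDensity_eq :
    posteriorDensity M K Q n x y =
      priorDensity (updateM M K x y) (updateK K x) (updateQ M K Q x y) (n + 1) := by
  funext θ
  rw [posteriorDensity, predictiveDensity_eq M hK hQ hn, jointDensity_eq M hK hQ hn,
    mul_div_cancel_left₀ _ (Real.exp_pos _).ne']

end Posterior

/-! ### Entropy of the prior by tilting -/

/-- The degrees of freedom of the normalized power `f ^ (1 + t)` of a prior density `f`. -/
noncomputable def tiltedDof (d m : ℕ) (n t : ℝ) : ℝ := n + t * (n + d + 1 + m)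

/-- The part of `log ∫ f ^ (1 + t)` that depends only on the degrees of freedom. -/
noncomputable def logMomentConst (d m : ℕ) (n t : ℝ) : ℝ :=
  t * (d + 1 + m) * d / 2 * Real.log 2 - t * (d * m / 2) * Real.log (2 * Real.pi) -
    (1 + t) * Real.log (wishartZ n d) + Real.log (wishartZ (tiltedDof d m n t) d) -
    (d * m / 2 + tiltedDof d m n t * d / 2) * Real.log (1 + t)

/-- The part of the entropy of the prior that depends only on the degrees of freedom. -/
noncomputable def entropyConst (d m : ℕ) (n : ℝ) : ℝ :=
  -deriv (fun t => Real.exp (logMomentConst d m n t)) 0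

/-- The part of the entropy of the prior that depends on the matrix parameters, up to sign. -/
noncomputable def entropyScale {d m : ℕ} (K : Matrix (Fin m) (Fin m) ℝ)
    (Q : Matrix (Fin d) (Fin d) ℝ) : ℝ :=
  (d : ℝ) / 2 * Real.log K.det - (d + m + 1) / 2 * Real.log Q.det

/-- The power `f ^ (1 + t)` of a prior density is proportional to a prior density. -/
theorem priorDensity_mul_exp_log {d m : ℕ} (M : Matrix (Fin d) (Fin m) ℝ)
    {K : Matrix (Fin m) (Fin m) ℝ} {Q : Matrix (Fin d) (Fin d) ℝ} {n t : ℝ} (hK : K.PosDef)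
    (hQ : Q.PosDef) (hn : (d : ℝ) - 1 < n) (ht : 0 < 1 + t)
    (hnt : (d : ℝ) - 1 < tiltedDof d m n t) (θ : Param d m) :
    priorDensity M K Q n θ * Real.exp (t * Real.log (priorDensity M K Q n θ)) =
      Real.exp (t * entropyScale K Q + logMomentConst d m n t) *
        priorDensity M ((1 + t) • K) ((1 + t) • Q) (tiltedDof d m n t) θ := by
  by_cases hθ : θ.cov.PosDef
  · have hKd := hK.det_pos
    have hQd := hQ.det_pos
    -- The exponent is linear in (K, Q). The power of |V| matches because (1+t)(n+d+1+m) equals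
    -- `tiltedDof` plus d+1+m.
    have hexp : priorExponent M ((1 + t) • K) ((1 + t) • Q) θ =
        (1 + t) * priorExponent M K Q θ := by
      rw [priorExponent, priorExponent, Matrix.mul_smul, Matrix.mul_smul, Matrix.trace_smul,
        Matrix.trace_smul, smul_eq_mul, smul_eq_mul, mul_add]
    rw [priorDensity_of_posDef M hK hQ hn hθ,
      priorDensity_of_posDef M (hK.smul ht) (hQ.smul ht) hnt hθ, Real.log_exp, hexp,
      ← Real.exp_add, ← Real.exp_add, logPriorConst, logPriorConst, log_det_smul ht hK,
      log_det_smul ht hQ, entropyScale, logMomentConst, tiltedDof]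
    congr 1
    ring
  · rw [priorDensity_of_not_posDef _ _ _ _ hθ, priorDensity_of_not_posDef _ _ _ _ hθ,
      zero_mul, mul_zero]

/-- The entropy of the prior, with absolute convergence. -/
theorem entropy_priorDensity {d m : ℕ} (M : Matrix (Fin d) (Fin m) ℝ)
    {K : Matrix (Fin m) (Fin m) ℝ} {Q : Matrix (Fin d) (Fin d) ℝ} {n : ℝ} (hK : K.PosDef)
    (hQ : Q.PosDef) (hn : (d : ℝ) - 1 < n) :
    Integrable (fun θ => priorDensity M K Q n θ * Real.log (priorDensity M K Q n θ)) ∧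
      differentialEntropy (priorDensity M K Q n) = -entropyScale K Q + entropyConst d m n := by
  obtain ⟨f, hf⟩ : ∃ f, f = priorDensity M K Q n := ⟨_, rfl⟩
  have hfm : Measurable f := hf ▸ measurable_priorDensity M hK hQ hn
  have hf0 : ∀ θ, 0 ≤ f θ := hf ▸ priorDensity_nonneg M hK hQ hn
  obtain ⟨μ, hμ⟩ : ∃ μ : Measure (Param d m),
    μ = volume.withDensity fun θ => ENNReal.ofReal (f θ) := ⟨_, rfl⟩
  have hint : ∀ g : Param d m → ℝ, Integrable g μ ↔ Integrable fun θ => f θ * g θ := by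
    intro g
    rw [hμ, integrable_withDensity_iff_integrable_smul' hfm.ennreal_ofReal
      (.of_forall fun _ => ENNReal.ofReal_lt_top)]
    simp only [ENNReal.toReal_ofReal (hf0 _), smul_eq_mul]
  have hval : ∀ g : Param d m → ℝ, ∫ θ, g θ ∂μ = ∫ θ, f θ * g θ := by
    intro g
    rw [hμ, integral_withDensity_eq_integral_toReal_smul hfm.ennreal_ofReal
      (.of_forall fun _ => ENNReal.ofReal_lt_top)]
    simp only [ENNReal.toReal_ofReal (hf0 _), smul_eq_mul]
  -- The condition n > d - 1 is open, so the tilted parameters stay admissible on both sides of 0.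
  -- This puts 0 in the interior of the domain of the generating function.
  have hnear : ∀ᶠ t : ℝ in nhds 0, 0 < 1 + t ∧ (d : ℝ) - 1 < tiltedDof d m n t := by
    have h1 : ContinuousAt (fun t : ℝ => 1 + t) 0 := by fun_prop
    have h2 : ContinuousAt (fun t : ℝ => tiltedDof d m n t) 0 := by
      unfold tiltedDof
      fun_prop
    exact (h1.eventually (lt_mem_nhds (by simp))).and
      (h2.eventually (lt_mem_nhds (by simpa [tiltedDof] using hn)))
  have hmem : (0 : ℝ) ∈ interior (ProbabilityTheory.integrableExpSet (fun θ => Real.log (f θ)) μ) := by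
    rw [mem_interior_iff_mem_nhds]
    filter_upwards [hnear] with t ht
    change Integrable _ _
    rw [hint, hf]
    simp_rw [priorDensity_mul_exp_log M hK hQ hn ht.1 ht.2]
    exact (integrable_priorDensity M (hK.smul ht.1) (hQ.smul ht.1) ht.2).const_mul _
  have hmgf : ∀ᶠ t : ℝ in nhds 0, ProbabilityTheory.mgf (fun θ => Real.log (f θ)) μ t =
      Real.exp (t * entropyScale K Q + logMomentConst d m n t) := by
    filter_upwards [hnear] with t ht
    rw [ProbabilityTheory.mgf, hval, hf]
    simp_rw [priorDensity_mul_exp_log M hK hQ hn ht.1 ht.2]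
    rw [integral_const_mul, integral_priorDensity M (hK.smul ht.1) (hQ.smul ht.1) ht.2, mul_one]
  have hlog := ProbabilityTheory.integrable_of_mem_interior_integrableExpSet hmem
  have hmgf0 : ProbabilityTheory.mgf (fun θ => Real.log (f θ)) μ 0 = 1 := by
    rw [ProbabilityTheory.mgf, hval]
    simpa [hf] using integral_priorDensity M hK hQ hn
  have hderiv : HasDerivAt (ProbabilityTheory.mgf (fun θ => Real.log (f θ)) μ)
      (∫ θ, f θ * Real.log (f θ)) 0 := by
    rw [← hval, ← ProbabilityTheory.deriv_mgf_zero hmem]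
    exact (ProbabilityTheory.differentiableAt_mgf hmem).hasDerivAt
  have hexp : HasDerivAt (fun t : ℝ => Real.exp (-(t * entropyScale K Q)))
      (-entropyScale K Q) 0 := by
    simpa using (((hasDerivAt_id (0 : ℝ)).mul_const (entropyScale K Q)).neg).exp
  -- Differentiability of the explicit constant is inherited from the generating function, so no
  -- derivative of Γ is computed.
  have hconst : deriv (fun t => Real.exp (logMomentConst d m n t)) 0 =
      (∫ θ, f θ * Real.log (f θ)) - entropyScale K Q := by
    have heq : (fun t => Real.exp (logMomentConst d m n t)) =ᶠ[nhds 0] fun t =>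
        ProbabilityTheory.mgf (fun θ => Real.log (f θ)) μ t *
          Real.exp (-(t * entropyScale K Q)) := by
      filter_upwards [hmgf] with t ht
      rw [ht, ← Real.exp_add]
      congr 1
      ring
    rw [heq.deriv_eq, (hderiv.fun_mul hexp).deriv, hmgf0]
    simp [sub_eq_add_neg]
  rw [← hf]
  refine ⟨(hint _).mp hlog, ?_⟩
  rw [differentialEntropy, entropyConst, hconst]
  ring

/-! ### The predictive density as a rescaled t density -/

theorem normalDensity_nonneg {d : ℕ} (μ : Fin d → ℝ) {V : Matrix (Fin d) (Fin d) ℝ}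
    (hV : V.PosDef) (y : Fin d → ℝ) : 0 ≤ normalDensity μ V y := by
  rw [normalDensity_of_posDef μ hV]
  exact (Real.exp_pos _).le

theorem lintegral_normalDensity {d : ℕ} (μ : Fin d → ℝ) {V : Matrix (Fin d) (Fin d) ℝ}
    (hV : V.PosDef) : ∫⁻ y, ENNReal.ofReal (normalDensity μ V y) = 1 := by
  have hsplit : ∀ y, ENNReal.ofReal (normalDensity μ V y) =
      ENNReal.ofReal (Real.exp (-(d / 2 * Real.log (2 * Real.pi)) - 1 / 2 * Real.log V.det)) *
        ENNReal.ofReal (Real.exp (-(1 / 2) * ((y - μ) ⬝ᵥ (V⁻¹ *ᵥ (y - μ))))) := by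
    intro y
    rw [normalDensity_of_posDef μ hV, ← ENNReal.ofReal_mul (Real.exp_pos _).le, ← Real.exp_add]
    congr 2
    ring
  simp_rw [hsplit]
  rw [lintegral_const_mul' _ _ ENNReal.ofReal_ne_top,
    lintegral_sub_right_eq_self (μ := (volume : Measure (Fin d → ℝ)))
      (fun y => ENNReal.ofReal (Real.exp (-(1 / 2) * (y ⬝ᵥ (V⁻¹ *ᵥ y))))) μ,
    lintegral_exp_neg_half_quadratic hV.inv, ← ENNReal.ofReal_mul (Real.exp_pos _).le,
    ← Real.exp_add, Matrix.det_nonsing_inv, Ring.inverse_eq_inv', Real.log_inv, Fintype.card_fin,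
    ← ENNReal.ofReal_one, ← Real.exp_zero]
  congr 2
  ring

theorem measurable_normalDensity_coeff {d m : ℕ} (x : Fin m → ℝ) :
    Measurable fun p : Param d m × (Fin d → ℝ) =>
      normalDensity (p.1.coeff *ᵥ x) p.1.cov p.2 := by
  have h1 : Measurable fun p : Param d m × (Fin d → ℝ) => ((2 * Real.pi) • p.1.cov).det := by
    simp_rw [Matrix.det_smul]
    exact ((measurable_det_cov d m).comp measurable_fst).const_mul _
  have h2 : ∀ i, Measurable fun p : Param d m × (Fin d → ℝ) => (p.2 - p.1.coeff *ᵥ x) i := by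
    intro i
    refine ((measurable_pi_apply i).comp measurable_snd).sub ?_
    change Measurable fun p : Param d m × (Fin d → ℝ) => ∑ j, p.1.coeff i j * x j
    exact Finset.measurable_sum _ fun j _ =>
      ((measurable_coeff_apply i j).comp measurable_fst).mul_const _
  have h3 : ∀ i, Measurable fun p : Param d m × (Fin d → ℝ) =>
      (p.1.cov⁻¹ *ᵥ (p.2 - p.1.coeff *ᵥ x)) i := by
    intro i
    change Measurable fun p : Param d m × (Fin d → ℝ) =>
      ∑ j, p.1.cov⁻¹ i j * (p.2 - p.1.coeff *ᵥ x) j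
    exact Finset.measurable_sum _ fun j _ =>
      ((measurable_inv_cov_apply i j).comp measurable_fst).mul (h2 j)
  have h4 : Measurable fun p : Param d m × (Fin d → ℝ) => (p.2 - p.1.coeff *ᵥ x) ⬝ᵥ
      (p.1.cov⁻¹ *ᵥ (p.2 - p.1.coeff *ᵥ x)) :=
    Finset.measurable_sum _ fun i _ => (h2 i).mul (h3 i)
  exact (h1.pow_const _).inv.mul (h4.const_mul _).exp

section Predictive

variable {d m : ℕ} (M : Matrix (Fin d) (Fin m) ℝ) {K : Matrix (Fin m) (Fin m) ℝ}
  {Q : Matrix (Fin d) (Fin d) ℝ} {n : ℝ}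

/-- By Tonelli y may be integrated first; the normal density has mass one, and so has the prior. -/
theorem lintegral_predictiveDensity (hK : K.PosDef) (hQ : Q.PosDef) (hn : (d : ℝ) - 1 < n)
    (x : Fin m → ℝ) : ∫⁻ y, ENNReal.ofReal (predictiveDensity M K Q n x y) = 1 := by
  have hmeas : Measurable fun p : (Fin d → ℝ) × Param d m =>
      ENNReal.ofReal (jointDensity M K Q n x p.1 p.2) :=
    ((((measurable_normalDensity_coeff x).comp measurable_swap).mul
      ((measurable_priorDensity M hK hQ hn).comp measurable_snd))).ennreal_ofReal
  have h1 : ∀ y, ENNReal.ofReal (predictiveDensity M K Q n x y) =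
      ∫⁻ θ, ENNReal.ofReal (jointDensity M K Q n x y θ) := by
    intro y
    simp_rw [jointDensity_eq M hK hQ hn x y, ENNReal.ofReal_mul (Real.exp_pos _).le]
    rw [lintegral_const_mul' _ _ ENNReal.ofReal_ne_top, lintegral_priorDensity _
      (posDef_updateK hK x) (posDef_updateQ M hK hQ x y) (by linarith), mul_one,
      predictiveDensity_eq M hK hQ hn]
  have h2 : ∀ θ : Param d m, ∫⁻ y, ENNReal.ofReal (jointDensity M K Q n x y θ) =
      ENNReal.ofReal (priorDensity M K Q n θ) := by
    intro θ
    by_cases hθ : θ.cov.PosDef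
    · simp_rw [jointDensity, ENNReal.ofReal_mul (normalDensity_nonneg _ hθ _)]
      rw [lintegral_mul_const' _ _ ENNReal.ofReal_ne_top, lintegral_normalDensity _ hθ, one_mul]
    · simp [jointDensity, priorDensity_of_not_posDef _ _ _ _ hθ]
  simp_rw [h1]
  rw [lintegral_lintegral_swap hmeas.aemeasurable]
  simp_rw [h2]
  exact lintegral_priorDensity M hK hQ hn

end Predictive

/-- The part of the logarithm of the standardized predictive density that does not depend on the
observation. -/
noncomputable def studentLogConst {d : ℕ} (Q : Matrix (Fin d) (Fin d) ℝ) (n : ℝ) : ℝ :=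
  d / 2 * Real.log 2 - d / 2 * Real.log (2 * Real.pi) - Real.log (wishartZ n d) +
    Real.log (wishartZ (n + 1) d) + n / 2 * Real.log Q.det

/-- The logarithm of the standardized predictive density, a multivariate t density. -/
noncomputable def studentLog {d : ℕ} (Q : Matrix (Fin d) (Fin d) ℝ) (n : ℝ) (z : Fin d → ℝ) : ℝ :=
  studentLogConst Q n - (n + 1) / 2 * Real.log (Q + Matrix.vecMulVec z z).det

theorem updateQ_eq {d m : ℕ} (M : Matrix (Fin d) (Fin m) ℝ) {K : Matrix (Fin m) (Fin m) ℝ}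
    (Q : Matrix (Fin d) (Fin d) ℝ) (hK : K.PosDef) (x : Fin m → ℝ) (y : Fin d → ℝ) :
    updateQ M K Q x y = Q + Matrix.vecMulVec (√(shrink K x) • (y - M *ᵥ x))
      (√(shrink K x) • (y - M *ᵥ x)) := by
  rw [updateQ, Matrix.smul_vecMulVec, Matrix.vecMulVec_smul, smul_smul,
    Real.mul_self_sqrt (shrink_pos hK x).le]

theorem logPredictive_eq {d m : ℕ} (M : Matrix (Fin d) (Fin m) ℝ) {K : Matrix (Fin m) (Fin m) ℝ}
    (Q : Matrix (Fin d) (Fin d) ℝ) (n : ℝ) (hK : K.PosDef) (x : Fin m → ℝ) (y : Fin d → ℝ) :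
    logPredictive M K Q n x y = d / 2 * Real.log (shrink K x) +
      studentLog Q n (√(shrink K x) • (y - M *ᵥ x)) := by
  rw [logPredictive, logPriorConst, logPriorConst, studentLog, studentLogConst,
    ← updateQ_eq M Q hK, log_shrink hK]
  ring

theorem continuous_studentDet {d : ℕ} (Q : Matrix (Fin d) (Fin d) ℝ) :
    Continuous fun z : Fin d → ℝ => (Q + Matrix.vecMulVec z z).det :=
  (continuous_const.add (continuous_id.matrix_vecMulVec continuous_id)).matrix_det

theorem measurable_studentLog {d : ℕ} (Q : Matrix (Fin d) (Fin d) ℝ) (n : ℝ) :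
    Measurable (studentLog Q n) :=
  measurable_const.sub ((Real.measurable_log.comp (continuous_studentDet Q).measurable).const_mul _)

/-- With zero input dimensions the scale factor is 1 and the predictive density is the standardized
density itself, so its mass is already known. -/
theorem lintegral_exp_studentLog {d : ℕ} {Q : Matrix (Fin d) (Fin d) ℝ} {n : ℝ} (hQ : Q.PosDef)
    (hn : (d : ℝ) - 1 < n) : ∫⁻ z, ENNReal.ofReal (Real.exp (studentLog Q n z)) = 1 := by
  have h := lintegral_predictiveDensity (0 : Matrix (Fin d) (Fin 0) ℝ) Matrix.PosDef.one hQ hn 0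
  have hs : shrink (1 : Matrix (Fin 0) (Fin 0) ℝ) 0 = 1 := by simp [shrink]
  simpa only [predictiveDensity_eq _ Matrix.PosDef.one hQ hn,
    logPredictive_eq _ _ _ Matrix.PosDef.one, hs, Real.log_one, mul_zero, zero_add, Real.sqrt_one,
    one_smul, Matrix.zero_mulVec, sub_zero] using h

theorem integrable_exp_studentLog {d : ℕ} {Q : Matrix (Fin d) (Fin d) ℝ} {n : ℝ} (hQ : Q.PosDef)
    (hn : (d : ℝ) - 1 < n) : Integrable fun z => Real.exp (studentLog Q n z) := by
  refine ⟨(measurable_studentLog Q n).exp.aestronglyMeasurable, ?_⟩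
  rw [hasFiniteIntegral_iff_ofReal (.of_forall fun _ => (Real.exp_pos _).le),
    lintegral_exp_studentLog hQ hn]
  exact ENNReal.one_lt_top

theorem integral_exp_studentLog {d : ℕ} {Q : Matrix (Fin d) (Fin d) ℝ} {n : ℝ} (hQ : Q.PosDef)
    (hn : (d : ℝ) - 1 < n) : ∫ z, Real.exp (studentLog Q n z) = 1 := by
  rw [integral_eq_lintegral_of_nonneg_ae (.of_forall fun _ => (Real.exp_pos _).le)
    (measurable_studentLog Q n).exp.aestronglyMeasurable, lintegral_exp_studentLog hQ hn]
  simp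

/-- The logarithm is dominated by small powers of the determinant of both signs. Multiplying by them
shifts n by ∓2e and gives multiples of other t densities. -/
theorem integrable_exp_studentLog_mul_log {d : ℕ} {Q : Matrix (Fin d) (Fin d) ℝ} {n : ℝ}
    (hQ : Q.PosDef) (hn : (d : ℝ) - 1 < n) :
    Integrable fun z => Real.exp (studentLog Q n z) *
      Real.log (Q + Matrix.vecMulVec z z).det := by
  -- With this e, n - 2e is the midpoint of n and d - 1, hence still admissible.
  obtain ⟨e, he⟩ : ∃ e, e = (n - d + 1) / 4 := ⟨_, rfl⟩
  have he0 : 0 < e := by rw [he]; linarith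
  have h1 := (integrable_exp_studentLog hQ (n := n - 2 * e) (by linarith)).const_mul
    (Real.exp (studentLogConst Q n - studentLogConst Q (n - 2 * e)) / e)
  have h2 := (integrable_exp_studentLog hQ (n := n + 2 * e) (by linarith)).const_mul
    (Real.exp (studentLogConst Q n - studentLogConst Q (n + 2 * e)) / e)
  refine (h1.add h2).mono' ((measurable_studentLog Q n).exp.mul
    (Real.measurable_log.comp (continuous_studentDet Q).measurable)).aestronglyMeasurable
    (.of_forall fun z => ?_)
  obtain ⟨u, hu⟩ : ∃ u, u = Real.log (Q + Matrix.vecMulVec z z).det := ⟨_, rfl⟩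
  have habs : |u| ≤ (Real.exp (e * u) + Real.exp (-(e * u))) / e := by
    rw [le_div_iff₀ he0]
    have hp := Real.add_one_le_exp (e * u)
    have hm := Real.add_one_le_exp (-(e * u))
    have hp0 := Real.exp_pos (e * u)
    have hm0 := Real.exp_pos (-(e * u))
    rcases abs_cases u with ⟨h, _⟩ | ⟨h, _⟩ <;> rw [h] <;> linarith
  rw [Real.norm_eq_abs, abs_mul, abs_of_pos (Real.exp_pos _), ← hu]
  refine (mul_le_mul_of_nonneg_left habs (Real.exp_pos _).le).trans (le_of_eq ?_)
  simp only [Pi.add_apply]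
  rw [mul_div_assoc', mul_add, ← Real.exp_add, ← Real.exp_add, div_mul_eq_mul_div,
    div_mul_eq_mul_div, ← Real.exp_add, ← Real.exp_add, ← add_div, studentLog, studentLog,
    studentLog, ← hu]
  congr 3
  · ring
  · ring

/-! ### Averaging the posterior entropy -/

section Standardize

variable {d : ℕ} {s : ℝ}

theorem integrable_standardize (hs : 0 < s) (c : Fin d → ℝ) {G : (Fin d → ℝ) → ℝ}
    (hG : Integrable G) :
    Integrable fun y => Real.exp (d / 2 * Real.log s) * G (√s • (y - c)) :=
  (((integrable_comp_smul_iff volume G (Real.sqrt_pos.mpr hs).ne').mpr hG).comp_sub_right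
    c).const_mul _

theorem integral_standardize (hs : 0 < s) (c : Fin d → ℝ) (G : (Fin d → ℝ) → ℝ) :
    ∫ y, Real.exp (d / 2 * Real.log s) * G (√s • (y - c)) = ∫ z, G z := by
  have hpow : Real.exp (d / 2 * Real.log s) = √s ^ d := by
    rw [Real.sqrt_eq_rpow, ← Real.rpow_mul_natCast hs.le, Real.rpow_def_of_pos hs]
    congr 1
    ring
  have hpos : 0 < √s ^ d := pow_pos (Real.sqrt_pos.mpr hs) d
  rw [integral_const_mul, integral_sub_right_eq_self (fun y => G (√s • y)) c,
    Measure.integral_comp_smul, Module.finrank_fin_fun, abs_of_pos (inv_pos.mpr hpos), hpow,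
    smul_eq_mul, mul_inv_cancel_left₀ hpos.ne']

end Standardize

/-- The part of the conditional entropy that depends only on `Q` and `n`. -/
noncomputable def entropyOffset (d m : ℕ) (Q : Matrix (Fin d) (Fin d) ℝ) (n : ℝ) : ℝ :=
  (d + m + 1) / 2 * (∫ z, Real.exp (studentLog Q n z) *
    Real.log (Q + Matrix.vecMulVec z z).det) + entropyConst d m (n + 1)

/-- The right side is the Jacobian times a function of the standardized variable, the form that
`integral_standardize` requires. In that function x and K occur only through |K'|, as a coefficient
of a density of mass one. -/
theorem predictiveDensity_mul_posteriorEntropy {d m : ℕ} (M : Matrix (Fin d) (Fin m) ℝ)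
    {K : Matrix (Fin m) (Fin m) ℝ} {Q : Matrix (Fin d) (Fin d) ℝ} {n : ℝ} (hK : K.PosDef)
    (hQ : Q.PosDef) (hn : (d : ℝ) - 1 < n) (x : Fin m → ℝ) (y : Fin d → ℝ) :
    predictiveDensity M K Q n x y * posteriorEntropy M K Q n x y =
      Real.exp (d / 2 * Real.log (shrink K x)) * (fun z => ((d + m + 1) / 2 *
        (Real.exp (studentLog Q n z) * Real.log (Q + Matrix.vecMulVec z z).det) +
        (-(d / 2) * Real.log (updateK K x).det + entropyConst d m (n + 1)) *
          Real.exp (studentLog Q n z))) (√(shrink K x) • (y - M *ᵥ x)) := by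
  rw [predictiveDensity_eq M hK hQ hn, posteriorEntropy, posteriorDensity_eq M hK hQ hn,
    (entropy_priorDensity _ (posDef_updateK hK x) (posDef_updateQ M hK hQ x y)
      (by linarith)).2, entropyScale, logPredictive_eq M Q n hK, Real.exp_add, updateQ_eq M Q hK]
  ring

end BayesInfomax

theorem mainTheorem7 (d m : ℕ) :
    ∃ g₁ : Matrix (Fin d) (Fin d) ℝ → ℝ → ℝ,
      ∀ (Q : Matrix (Fin d) (Fin d) ℝ) (n : ℝ) (M : Matrix (Fin d) (Fin m) ℝ)
        (K : Matrix (Fin m) (Fin m) ℝ) (x : Fin m → ℝ),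
        Q.PosDef → (d : ℝ) - 1 < n → K.PosDef →
          (∀ y : Fin d → ℝ, 0 < BayesInfomax.predictiveDensity M K Q n x y) ∧
          (∀ y : Fin d → ℝ, Integrable (fun θ : BayesInfomax.Param d m =>
            BayesInfomax.posteriorDensity M K Q n x y θ *
              Real.log (BayesInfomax.posteriorDensity M K Q n x y θ))) ∧
          Integrable (fun y : Fin d → ℝ =>
            BayesInfomax.predictiveDensity M K Q n x y *
              BayesInfomax.posteriorEntropy M K Q n x y) ∧
          BayesInfomax.expectedPosteriorEntropy M K Q n x =
            -((d : ℝ) / 2) * Real.log (Matrix.vecMulVec x x + K).det + g₁ Q n := by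
  open BayesInfomax in
  refine ⟨entropyOffset d m, fun Q n M K x hQ hn hK => ?_⟩
  have h1 := (integrable_exp_studentLog_mul_log hQ hn).const_mul (((d : ℝ) + m + 1) / 2)
  have h2 := (integrable_exp_studentLog hQ hn).const_mul
    (-((d : ℝ) / 2) * Real.log (updateK K x).det + entropyConst d m (n + 1))
  refine ⟨fun y => ?_, fun y => ?_, ?_, ?_⟩
  · rw [predictiveDensity_eq M hK hQ hn]
    exact Real.exp_pos _
  · rw [posteriorDensity_eq M hK hQ hn]
    exact (entropy_priorDensity _ (posDef_updateK hK x) (posDef_updateQ M hK hQ x y)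
      (by linarith)).1
  · simp_rw [predictiveDensity_mul_posteriorEntropy M hK hQ hn]
    exact integrable_standardize (shrink_pos hK x) _ (h1.add h2)
  · rw [expectedPosteriorEntropy]
    simp_rw [predictiveDensity_mul_posteriorEntropy M hK hQ hn]
    refine (integral_standardize (shrink_pos hK x) (M *ᵥ x) (fun z => ((d : ℝ) + m + 1) / 2 *
      (Real.exp (studentLog Q n z) * Real.log (Q + Matrix.vecMulVec z z).det) +
      (-((d : ℝ) / 2) * Real.log (updateK K x).det + entropyConst d m (n + 1)) *
        Real.exp (studentLog Q n z))).trans ?_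
    rw [integral_add h1 h2, integral_const_mul, integral_const_mul, integral_exp_studentLog hQ hn, entropyOffset,
      updateK]
    ring
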